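/- Let $d\ge 0$, $\gamma\in[0,1/2]$ and $s\ge 0$ be fixed. $G^{\mathrm{bip}}_{n,d}$ is the random bipartite graph with parts $L,R$ of size $n$ in which each pair in $L\times R$ is an edge independently with probability $d/n$ (truncated to $1$ if $n<d$). An *$s$-local function* $g=g(H,\mathbf x)$ takes a finite rooted graph $H$ of depth at most $s$ with labels $\mathbf x\in[0,1]^{V(H)}$ and returns a bit in $\{0,1\}$; it is measurable in $\mathbf x$ and invariant under isomorphisms of rooted labelled graphs. It is applied at a vertex $v$ of a graph by evaluating it on the depth-$s$ neighborhood of $v$, rooted at $v$, with the restricted labels. A pair $(g_\ell,g_r)$ of $s$-local functions is *compatible* if for every finite bipartite graph $G$ with bipartition $(L,R)$ and all $\mathbf x\in[0,1]^{V(G)}$, the set of vertices at which the output is $1$, when $g_\ell$ is applied at the vertices of $L$ and $g_r$ at those of $R$, is independent. An independent set $I$ is *$\gamma$-balanced* if $\big||I\cap L|-\gamma|I|\big|<1$. Put $$\alpha_{d,\gamma}(g_\ell,g_r)=\frac12\min\Big\{\frac1\gamma\,\mathbb E[g_\ell(\mathbf T,\mathbf x)],\ \frac1{1-\gamma}\,\mathbb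 E[g_r(\mathbf T,\mathbf x)]\Big\},$$ where $\mathbf T$ is the rooted $\mathrm{Pois}(d)$ Galton--Watson tree, $\mathbf x$ are iid $\mathrm{Unif}[0,1]$ labels on its vertices, and $g(\mathbf T,\mathbf x)$ is $g$ applied at the root; for $\gamma=0$ the minimum is read as its second term. **Lemma.** Let $(g_\ell,g_r)$ be a compatible pair of $s$-local functions. Let $X$ be the random independent set obtained by applying $(g_\ell,g_r)$ to $G^{\mathrm{bip}}_{n,d}$ with iid $\mathrm{Unif}[0,1]$ vertex labels, and let $X_\gamma$ be a largest $\gamma$-balanced independent set contained in $X$. Then with high probability over the graph and the labels $$\frac{|X_\gamma|}{2n}=\alpha_{d,\gamma}(g_\ell,g_r)+o(1),$$ that is, for every $\varepsilon>0$, $\ \mathbb P\Big(\Big|\frac{|X_\gamma|}{2n}-\alpha_{d,\gamma}(g_\ell,g_r)\Big|>\varepsilon\Big)\to0$ as $n\to\infty$. -/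

import Mathlib

open MeasureTheory ProbabilityTheory Filter Topology
open scoped unitInterval NNReal

namespace BipLocal

/-! ### Rooted graphs of bounded depth and neighborhoods -/

/-- The rooted graph `(H, r)` has depth at most `s`: every vertex can be reached from the root `r`
by a walk of length at most `s`. In particular `H` is connected. -/
def HasDepthLE {V : Type} (H : SimpleGraph V) (r : V) (s : ℕ) : Prop :=
  ∀ u : V, ∃ w : H.Walk r u, w.length ≤ s

/-- The set of vertices at graph distance at most `s` from `v`. -/
def nbhd {V : Type} (G : SimpleGraph V) (s : ℕ) (v : V) : Set V :=
  {u | ∃ w : G.Walk v u, w.length ≤ s}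

theorem self_mem_nbhd {V : Type} (G : SimpleGraph V) (s : ℕ) (v : V) : v ∈ nbhd G s v :=
  ⟨SimpleGraph.Walk.nil, Nat.zero_le s⟩

/-- The depth-`s` neighborhood of `v` in `G`, as a graph (to be rooted at `nbhdRoot G s v`). -/
def nbhdGraph {V : Type} (G : SimpleGraph V) (s : ℕ) (v : V) : SimpleGraph (nbhd G s v) :=
  G.induce (nbhd G s v)

/-- The vertex `v` as the root of its depth-`s` neighborhood. -/
def nbhdRoot {V : Type} (G : SimpleGraph V) (s : ℕ) (v : V) : nbhd G s v :=
  ⟨v, self_mem_nbhd G s v⟩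

theorem hasDepthLE_nbhd {V : Type} (G : SimpleGraph V) (s : ℕ) (v : V) :
    HasDepthLE (nbhdGraph G s v) (nbhdRoot G s v) s := by
  classical
  rintro ⟨u, w, hw⟩
  have hsub : ∀ z ∈ w.support, z ∈ nbhd G s v := fun z hz =>
    ⟨w.takeUntil z hz, (w.length_takeUntil_le_length hz).trans hw⟩
  refine ⟨w.induce (nbhd G s v) hsub, ?_⟩
  have h := congrArg SimpleGraph.Walk.length (SimpleGraph.Walk.map_induce w hsub)
  rw [SimpleGraph.Walk.length_map] at h
  exact h.trans_le hw

/-! ### Local functions -/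

/-- An `s`-local function: it takes a finite rooted graph `(H, r)` of depth at most `s` with
vertex labels `x` in `[0,1]` and returns a bit (`true` is `1`, "in"; `false` is `0`, "out").
It depends only on the isomorphism class of the labelled rooted graph, and is measurable in the
labels. -/
structure LocalFunction (s : ℕ) where
  /-- The output bit. -/
  toFun : ∀ {V : Type} [Finite V] (H : SimpleGraph V) (r : V), HasDepthLE H r s → (V → I) → Bool
  iso_invariant : ∀ {V W : Type} [Finite V] [Finite W] (H : SimpleGraph V) (K : SimpleGraph W)
    (e : H ≃g K) (r : V) (hH : HasDepthLE H r s) (hK : HasDepthLE K (e r) s) (x : W → I),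
    toFun H r hH (fun v => x (e v)) = toFun K (e r) hK x
  measurable_toFun : ∀ {V : Type} [Finite V] (H : SimpleGraph V) (r : V) (h : HasDepthLE H r s),
    Measurable (toFun H r h)

/-- Application of the local function `g` at the vertex `v` of a graph `G` with labels `x`:
`g` is evaluated on the depth-`s` neighborhood of `v` with the restricted labels. -/
def LocalFunction.eval {s : ℕ} (g : LocalFunction s) {V : Type} (G : SimpleGraph V)
    (x : V → I) (v : V) [Finite (nbhd G s v)] : Bool :=
  g.toFun (nbhdGraph G s v) (nbhdRoot G s v) (hasDepthLE_nbhd G s v) (fun u => x u)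

/-- The set of vertices returned by applying `gl` to the vertices in `L` and `gr` to the vertices
outside `L`, in the finite graph `G` with labels `x`. -/
def output {s : ℕ} (gl gr : LocalFunction s) {V : Type} [Finite V] (G : SimpleGraph V)
    (L : Set V) (x : V → I) : Set V :=
  {v | (v ∈ L ∧ gl.eval G x v = true) ∨ (v ∉ L ∧ gr.eval G x v = true)}

/-- The pair `gl`, `gr` is compatible: on every finite bipartite graph with bipartition `(L, Lᶜ)`
and for all labels, the output is an independent set. -/
def Compatible {s : ℕ} (gl gr : LocalFunction s) : Prop :=
  ∀ (V : Type) [Finite V] (G : SimpleGraph V) (L : Set V), G.IsBipartiteWith L Lᶜ →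
    ∀ x : V → I, G.IsIndepSet (output gl gr G L x)

/-! ### Balanced independent sets -/

/-- `J` is a `γ`-balanced independent set of `G`, where `L` is the left side of the bipartition:
`J` is independent and `| |J ∩ L| - γ |J| | < 1`. -/
def IsBalancedIndepSet {V : Type} (G : SimpleGraph V) (L : Set V) (γ : ℝ) (J : Set V) : Prop :=
  G.IsIndepSet J ∧ |((J ∩ L).ncard : ℝ) - γ * (J.ncard : ℝ)| < 1

open Classical in
/-- The size `|X_γ|` of a largest `γ`-balanced independent set contained in `X`. -/
noncomputable def maxBalancedCard {V : Type} [Fintype V] (G : SimpleGraph V) (L : Set V) (γ : ℝ)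
    (X : Set V) : ℕ :=
  ({J : Finset V | (J : Set V) ⊆ X ∧ IsBalancedIndepSet G L γ (J : Set V)} : Finset (Finset V)).sup
    Finset.card

/-! ### The random bipartite graph -/

/-- The bipartite graph with left vertices `Sum.inl i`, right vertices `Sum.inr j`, and an edge
between `Sum.inl i` and `Sum.inr j` exactly when `A (i, j) = true`. -/
def bipGraph {n : ℕ} (A : Fin n × Fin n → Bool) : SimpleGraph (Fin n ⊕ Fin n) where
  Adj u v := (∃ i j, A (i, j) = true ∧ u = Sum.inl i ∧ v = Sum.inr j) ∨
    (∃ i j, A (i, j) = true ∧ u = Sum.inr j ∧ v = Sum.inl i)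
  symm := ⟨by
    rintro u v (⟨i, j, h, hu, hv⟩ | ⟨i, j, h, hu, hv⟩)
    · exact Or.inr ⟨i, j, h, hv, hu⟩
    · exact Or.inl ⟨i, j, h, hv, hu⟩⟩
  loopless := ⟨by
    rintro u (⟨i, j, _, hu, hv⟩ | ⟨i, j, _, hu, hv⟩) <;> simp [hu] at hv⟩

/-- The left side `L` of the vertex set. -/
def leftSide (n : ℕ) : Set (Fin n ⊕ Fin n) := Set.range Sum.inl

/-- The edge probability `d / n` (truncated to `[0,1]`, which matters only for `n < d`). -/
noncomputable def edgeProb (n : ℕ) (d : ℝ≥0) : I :=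
  Set.projIcc (0 : ℝ) 1 zero_le_one ((d : ℝ) / (n : ℝ))

/-- Joint law of the edge indicators of the random bipartite graph on `n + n` vertices with edge
probability `d / n`, and of independent uniform labels on its vertices. -/
noncomputable def graphLabelMeasure (n : ℕ) (d : ℝ≥0) :
    Measure ((Fin n × Fin n → Bool) × (Fin n ⊕ Fin n → I)) :=
  (Measure.pi fun _ : Fin n × Fin n => bernoulliMeasure true false (edgeProb n d)).prod
    (Measure.pi fun _ : Fin n ⊕ Fin n => (volume : Measure I))

/-! ### The Poisson Galton-Watson tree -/

/-- With `N u` the number of children of the potential individual `u` (in Ulam-Harris notation,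
where the children of `u` are `0 :: u, 1 :: u, …`), the word `u` is a vertex of the family tree. -/
def IsTreeVertex (N : List ℕ → ℕ) : List ℕ → Prop
  | [] => True
  | i :: u => IsTreeVertex N u ∧ i < N u

/-- The family tree: its edges join each individual to its children. -/
def gwTree (N : List ℕ → ℕ) : SimpleGraph {u : List ℕ // IsTreeVertex N u} where
  Adj u v := (∃ i, v.1 = i :: u.1) ∨ (∃ i, u.1 = i :: v.1)
  symm := ⟨fun _ _ h => h.symm⟩
  loopless := ⟨by
    rintro u (⟨i, h⟩ | ⟨i, h⟩) <;> exact absurd (congrArg List.length h) (by simp)⟩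

/-- The root of the family tree. -/
def gwRoot (N : List ℕ → ℕ) : {u : List ℕ // IsTreeVertex N u} := ⟨[], trivial⟩

theorem finite_treeLevel (N : List ℕ → ℕ) (k : ℕ) :
    {u : List ℕ | IsTreeVertex N u ∧ u.length = k}.Finite := by
  induction k with
  | zero =>
    refine (Set.finite_singleton ([] : List ℕ)).subset ?_
    rintro u ⟨_, hu⟩
    simpa using hu
  | succ k ih =>
    refine (ih.biUnion fun u _ => (Set.finite_Iio (N u)).image fun i => i :: u).subset ?_
    rintro (_ | ⟨i, u⟩) ⟨hu, hl⟩
    · simp at hl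
    · simp only [Set.mem_iUnion]
      exact ⟨u, ⟨hu.1, by simpa using hl⟩, i, hu.2, rfl⟩

theorem length_le_of_walk (N : List ℕ → ℕ) {u v : {u : List ℕ // IsTreeVertex N u}}
    (w : (gwTree N).Walk u v) : v.1.length ≤ u.1.length + w.length := by
  induction w with
  | nil => simp
  | cons h p ih =>
    rw [SimpleGraph.Walk.length_cons]
    rcases h with ⟨i, h⟩ | ⟨i, h⟩
    · rw [h, List.length_cons] at ih
      omega
    · rw [h, List.length_cons]
      omega

instance finite_gwNbhd (N : List ℕ → ℕ) (s : ℕ) : Finite (nbhd (gwTree N) s (gwRoot N)) := by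
  have h : (⋃ k ∈ Set.Iic s, {u : List ℕ | IsTreeVertex N u ∧ u.length = k}).Finite :=
    (Set.finite_Iic s).biUnion fun k _ => finite_treeLevel N k
  refine Set.Finite.to_subtype (Set.Finite.subset (h.preimage Subtype.val_injective.injOn) ?_)
  rintro u ⟨w, hw⟩
  have hl : u.1.length ≤ 0 + w.length := length_le_of_walk N w
  simp only [Set.mem_preimage, Set.mem_iUnion]
  exact ⟨u.1.length, Set.mem_Iic.2 (by omega), u.2, rfl⟩

/-- Joint law of independent `Pois(d)` offspring numbers, which determine the Galton-Watson tree,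
and of independent uniform labels. -/
noncomputable def gwMeasure (d : ℝ≥0) : Measure ((List ℕ → ℕ) × (List ℕ → I)) :=
  (Measure.infinitePi fun _ : List ℕ => poissonMeasure d).prod
    (Measure.infinitePi fun _ : List ℕ => (volume : Measure I))

/-- The expectation `𝔼[g(T, x)]` of the local function `g`, applied at the root of the `Pois(d)`
Galton-Watson tree `T` with independent uniform labels `x` on its vertices. -/
noncomputable def gwExpectation {s : ℕ} (d : ℝ≥0) (g : LocalFunction s) : ℝ :=
  ∫ ω, (if g.eval (gwTree ω.1) (fun u => ω.2 u.1) (gwRoot ω.1) = true then (1 : ℝ) else 0)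
    ∂(gwMeasure d)

/-- The `γ`-balanced value `(1/2) min {𝔼[gl(T, x)] / γ, 𝔼[gr(T, x)] / (1 - γ)}`. For `γ = 0` the
convention is `1 / γ = ∞`: there is no constraint on the left, and the second term is the value. -/
noncomputable def balancedValue {s : ℕ} (d : ℝ≥0) (γ : ℝ) (gl gr : LocalFunction s) : ℝ :=
  if γ = 0 then 1 / 2 * gwExpectation d gr
  else 1 / 2 * min (1 / γ * gwExpectation d gl) (1 / (1 - γ) * gwExpectation d gr)

end BipLocal

/-!
For an output pattern `a` at finitely many distinct vertices of one side, its probability is bounded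
below by summing over finitely many placed forests of rooted trees: the exploration of the depth-`s`
neighborhoods determines the shapes of the trees and the positions of their vertices, so that these
events are disjoint. A forest has about `n ^ k` placements on `k` non-root vertices, each of them of
probability `p ^ k (1 - p) ^ (n r)` up to a bounded exponent, with `p = d / n` and `r` the number of
explored vertices, and the limit is the product of the `Pois(d)` weights of the shapes. The
probabilities of all patterns sum to `1` for the graph and for independent Galton-Watson trees
alike, so the lower bounds force convergence. For two vertices this is asymptotic independence, and
Chebyshev's inequality concentrates the number of outputs `1` on each side. Finally, a largest
`γ`-balanced subset of an independent set with `a` vertices on the left and `b` on the right has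
size `min {a / γ, b / (1 - γ)} + O(1)`.
-/

namespace BipLocal

/-! ### Local functions on embedded graphs -/

theorem nbhd_eq_range_of_embedding {V W : Type} {G : SimpleGraph V} {H : SimpleGraph W} {s : ℕ}
    {r : W} (hH : HasDepthLE H r s) (φ : H ↪g G)
    (hφ : ∀ u (p : H.Walk r u), p.length < s → ∀ y, G.Adj (φ u) y → y ∈ Set.range φ) :
    nbhd G s (φ r) = Set.range φ := by
  have mem_range_of_walk : ∀ {y z : V} (q : G.Walk y z) {u : W} (p : H.Walk r u),
      φ u = y → p.length + q.length ≤ s → z ∈ Set.range φ := by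
    intro y z q
    induction q with
    | nil => exact fun _ hu _ => ⟨_, hu⟩
    | cons h q ih =>
      rintro u p rfl hl
      rw [SimpleGraph.Walk.length_cons] at hl
      obtain ⟨w, rfl⟩ := hφ u p (by omega) _ h
      have huw : H.Adj u w := φ.map_adj_iff.1 h
      exact ih (p.concat huw) rfl (by rw [SimpleGraph.Walk.length_concat]; omega)
  refine Set.Subset.antisymm ?_ ?_
  · rintro y ⟨q, hq⟩
    exact mem_range_of_walk q .nil rfl (by simpa using hq)
  · rintro _ ⟨w, rfl⟩
    obtain ⟨p, hp⟩ := hH w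
    exact ⟨p.map φ.toHom, by simpa using hp⟩

theorem LocalFunction.eval_eq_of_embedding {s : ℕ} (g : LocalFunction s) {V W : Type} [Finite W]
    {G : SimpleGraph V} {H : SimpleGraph W} {r : W} (hH : HasDepthLE H r s) (φ : H ↪g G)
    (hφ : ∀ u (p : H.Walk r u), p.length < s → ∀ y, G.Adj (φ u) y → y ∈ Set.range φ)
    (x : V → I) {v : V} (hv : φ r = v) [Finite (nbhd G s v)] :
    g.eval G x v = g.toFun H r hH (fun w => x (φ w)) := by
  subst hv
  have hrange : Set.range φ = nbhd G s (φ r) := (nbhd_eq_range_of_embedding hH φ hφ).symm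
  let e : H ≃g nbhdGraph G s (φ r) :=
    { (Equiv.ofInjective φ φ.injective).trans (Equiv.setCongr hrange) with
      map_rel_iff' := φ.map_adj_iff }
  exact (g.iso_invariant H (nbhdGraph G s (φ r)) e r hH (hasDepthLE_nbhd G s (φ r))
    (fun u => x u)).symm

/-! ### Truncated trees -/

section TruncatedTree

/-- The vertices of the family tree of generation at most `s`. -/
abbrev TreeWord (N : List ℕ → ℕ) (s : ℕ) : Type :=
  {u : List ℕ // IsTreeVertex N u ∧ u.length ≤ s}

/-- The family tree truncated at generation `s`. -/
def treeGraph (N : List ℕ → ℕ) (s : ℕ) : SimpleGraph (TreeWord N s) :=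
  (gwTree N).comap fun u => ⟨u.1, u.2.1⟩

/-- The root of the truncated family tree. -/
def treeRoot (N : List ℕ → ℕ) (s : ℕ) : TreeWord N s := ⟨[], trivial, Nat.zero_le s⟩

/-- The vertices of the family tree of generation less than `s`. -/
abbrev InnerWord (N : List ℕ → ℕ) (s : ℕ) : Type :=
  {u : List ℕ // IsTreeVertex N u ∧ u.length < s}

/-- An inner vertex as a vertex of the truncated family tree. -/
def InnerWord.toTreeWord {N : List ℕ → ℕ} {s : ℕ} (w : InnerWord N s) : TreeWord N s :=
  ⟨w.1, w.2.1, w.2.2.le⟩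

/-- The `i`-th child of an inner vertex of the truncated family tree. -/
def InnerWord.child {N : List ℕ → ℕ} {s : ℕ} (w : InnerWord N s) (i : Fin (N w.1)) :
    TreeWord N s :=
  ⟨i :: w.1, ⟨w.2.1, i.2⟩, w.2.2⟩

/-- The parent of a vertex of the truncated family tree; the root is its own parent. -/
def TreeWord.parent {N : List ℕ → ℕ} {s : ℕ} : TreeWord N s → TreeWord N s
  | ⟨[], h⟩ => ⟨[], h⟩
  | ⟨_ :: u, h⟩ => ⟨u, h.1.1, (Nat.le_succ _).trans h.2⟩

/-- The offspring functions whose family trees agree with that of `K` up to generation `s`. -/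
def treeCylinder (K : List ℕ → ℕ) (s : ℕ) : Set (List ℕ → ℕ) :=
  {N | ∀ w : InnerWord K s, N w.1 = K w.1}

variable {N K : List ℕ → ℕ} {s : ℕ}

instance finite_treeWord : Finite (TreeWord N s) := by
  have h : (⋃ k ∈ Set.Iic s, {u : List ℕ | IsTreeVertex N u ∧ u.length = k}).Finite :=
    (Set.finite_Iic s).biUnion fun k _ => finite_treeLevel N k
  refine Set.Finite.to_subtype (h.subset ?_)
  rintro u ⟨hu, hl⟩
  simp only [Set.mem_iUnion]
  exact ⟨u.length, Set.mem_Iic.2 hl, hu, rfl⟩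

theorem InnerWord.toTreeWord_injective :
    Function.Injective (InnerWord.toTreeWord : InnerWord N s → TreeWord N s) :=
  fun _ _ h => Subtype.ext (Subtype.mk.inj h)

instance finite_innerWord : Finite (InnerWord N s) :=
  Finite.of_injective _ InnerWord.toTreeWord_injective

theorem treeGraph_adj_iff {u v : TreeWord N s} :
    (treeGraph N s).Adj u v ↔ ∃ (w : InnerWord N s) (i : Fin (N w.1)),
      (u = w.toTreeWord ∧ v = w.child i) ∨ (v = w.toTreeWord ∧ u = w.child i) := by
  constructor
  · obtain ⟨u, hu⟩ := u
    obtain ⟨v, hv⟩ := v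
    rintro (⟨i, rfl : v = i :: u⟩ | ⟨i, rfl : u = i :: v⟩)
    · exact ⟨⟨u, hu.1, hv.2⟩, ⟨i, hv.1.2⟩, .inl ⟨rfl, rfl⟩⟩
    · exact ⟨⟨v, hv.1, hu.2⟩, ⟨i, hu.1.2⟩, .inr ⟨rfl, rfl⟩⟩
  · rintro ⟨w, i, ⟨rfl, rfl⟩ | ⟨rfl, rfl⟩⟩
    · exact .inl ⟨i, rfl⟩
    · exact .inr ⟨i, rfl⟩

theorem InnerWord.adj_child (w : InnerWord N s) (i : Fin (N w.1)) :
    (treeGraph N s).Adj w.toTreeWord (w.child i) := .inl ⟨i, rfl⟩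

theorem InnerWord.child_ne_parent (w : InnerWord N s) (i : Fin (N w.1)) :
    w.child i ≠ w.toTreeWord.parent := by
  intro h
  rcases w with ⟨_ | ⟨j, u⟩, hw⟩
  · exact List.cons_ne_nil _ _ (congrArg Subtype.val h)
  · have hlen : u.length + 1 + 1 = u.length := congrArg (fun v : TreeWord N s => v.1.length) h
    omega

theorem length_le_of_treeGraph_walk {u : TreeWord N s} (p : (treeGraph N s).Walk (treeRoot N s) u) :
    u.1.length ≤ p.length := by
  let toTree : treeGraph N s →g gwTree N := ⟨fun u => ⟨u.1, u.2.1⟩, id⟩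
  have h := length_le_of_walk N (p.map toTree)
  rw [SimpleGraph.Walk.length_map] at h
  exact h.trans_eq (Nat.zero_add _)

theorem hasDepthLE_treeGraph (N : List ℕ → ℕ) (s : ℕ) :
    HasDepthLE (treeGraph N s) (treeRoot N s) s := by
  suffices h : ∀ (u : List ℕ) (hu : IsTreeVertex N u ∧ u.length ≤ s),
      ∃ w : (treeGraph N s).Walk (treeRoot N s) ⟨u, hu⟩, w.length = u.length by
    rintro ⟨u, hu⟩
    obtain ⟨w, hw⟩ := h u hu
    exact ⟨w, hw.trans_le hu.2⟩
  intro u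
  induction u with
  | nil => exact fun hu => ⟨.nil, rfl⟩
  | cons i u ih =>
    intro hu
    let v : InnerWord N s := ⟨u, hu.1.1, hu.2⟩
    obtain ⟨w, hw⟩ := ih v.toTreeWord.2
    have hadj : (treeGraph N s).Adj v.toTreeWord ⟨i :: u, hu⟩ := v.adj_child ⟨i, hu.1.2⟩
    refine ⟨w.concat hadj, ?_⟩
    exact (w.length_concat hadj).trans (by rw [hw, List.length_cons])

theorem isTreeVertex_iff_of_mem_treeCylinder (h : N ∈ treeCylinder K s) {u : List ℕ}
    (hu : u.length ≤ s) : IsTreeVertex N u ↔ IsTreeVertex K u := by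
  induction u with
  | nil => exact Iff.rfl
  | cons i u ih =>
    rw [IsTreeVertex, IsTreeVertex, ih (Nat.le_of_succ_le hu)]
    exact and_congr_right fun hK => by rw [h ⟨u, hK, hu⟩]

/-- The value of a local function at the root of the truncated family tree. -/
def LocalFunction.onTree (g : LocalFunction s) (K : List ℕ → ℕ) (y : TreeWord K s → I) : Bool :=
  g.toFun (treeGraph K s) (treeRoot K s) (hasDepthLE_treeGraph K s) y

theorem LocalFunction.measurable_onTree (g : LocalFunction s) (K : List ℕ → ℕ) :
    Measurable (g.onTree K) := g.measurable_toFun _ _ _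

theorem LocalFunction.eval_gwTree (g : LocalFunction s) (h : N ∈ treeCylinder K s)
    (y : List ℕ → I) :
    g.eval (gwTree N) (fun u => y u.1) (gwRoot N) = g.onTree K fun u => y u.1 := by
  let φ : treeGraph K s ↪g gwTree N :=
    { toFun := fun u => ⟨u.1, (isTreeVertex_iff_of_mem_treeCylinder h u.2.2).2 u.2.1⟩
      inj' := fun a b hab => Subtype.ext (Subtype.mk.inj hab)
      map_rel_iff' := Iff.rfl }
  refine g.eval_eq_of_embedding (hasDepthLE_treeGraph K s) φ (fun u p hp y hy => ?_)
    (fun u : {u : List ℕ // IsTreeVertex N u} => y u.1) (v := gwRoot N) rfl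
  have hlen : y.1.length ≤ u.1.length + 1 := length_le_of_walk N hy.toWalk
  have hu := length_le_of_treeGraph_walk p
  have hys : y.1.length ≤ s := by omega
  exact ⟨⟨y.1, (isTreeVertex_iff_of_mem_treeCylinder h hys).1 y.2, hys⟩, rfl⟩

end TruncatedTree

/-! ### Exploration of the bipartite graph -/

/-- The vertex number `i` on the left (`b = true`) or right (`b = false`) side. -/
def vtx {n : ℕ} (b : Bool) (i : Fin n) : Fin n ⊕ Fin n := if b then Sum.inl i else Sum.inr i

/-- The index of the potential edge between `vtx b i` and `vtx (!b) j`. -/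
def cell {n : ℕ} (b : Bool) (i j : Fin n) : Fin n × Fin n := if b then (i, j) else (j, i)

/-- The side of the vertex that is explored at the word `u`, starting from side `c`. -/
def sideOf (c : Bool) (u : List ℕ) : Bool := not^[u.length] c

/-- A numbering of the vertices of the forest of the family trees of `K r`, truncated at
generation `s`. Word `u` of tree `r` stands for the graph vertex `vtx (sideOf c u) (e r u)`. -/
abbrev Numbering {R : Type*} (K : R → List ℕ → ℕ) (s n : ℕ) : Type _ :=
  ∀ r, TreeWord (K r) s → Fin n

section Exploration

variable {R : Type*} {n s : ℕ} {c : Bool} {ρ : R → Fin n} {K K' : R → List ℕ → ℕ}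
  {e : Numbering K s n} {e' : Numbering K' s n} {A : Fin n × Fin n → Bool}

/-- The numbering `e` places the roots at `ρ`, without collisions in the whole forest. Siblings are
placed in increasing order, so that the plane forest can be read off from the explored graph. -/
structure IsPlacement (ρ : R → Fin n) (e : Numbering K s n) : Prop where
  injective : Function.Injective fun p : Σ r, TreeWord (K r) s => e p.1 p.2
  root : ∀ r, e r (treeRoot (K r) s) = ρ r
  strictMono_child : ∀ r (w : InnerWord (K r) s), StrictMono fun i => e r (w.child i)

/-- The neighbors in `bipGraph A` of the placed vertices of generation less than `s` are exactly
their placed tree neighbors. -/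
def Explores (A : Fin n × Fin n → Bool) (c : Bool) (e : Numbering K s n) : Prop :=
  ∀ r (w : InnerWord (K r) s) j, A (cell (sideOf c w.1) (e r w.toTreeWord) j) = true ↔
    ∃ v, (treeGraph (K r) s).Adj w.toTreeWord v ∧ e r v = j

theorem vtx_inj {b b' : Bool} {i j : Fin n} : vtx b i = vtx b' j ↔ b = b' ∧ i = j := by
  cases b <;> cases b' <;> simp [vtx]

theorem exists_eq_vtx (y : Fin n ⊕ Fin n) : ∃ b i, y = vtx b i := by
  rcases y with i | i
  exacts [⟨true, i, rfl⟩, ⟨false, i, rfl⟩]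

theorem cell_not (b : Bool) (i j : Fin n) : cell (!b) i j = cell b j i := by
  cases b <;> rfl

theorem eq_or_eq_swap_of_cell_eq {b b' : Bool} {i j i' j' : Fin n}
    (h : cell b i j = cell b' i' j') : (i = i' ∧ j = j') ∨ (i = j' ∧ j = i') := by
  cases b <;> cases b' <;> simp_all [cell]

theorem bipGraph_adj_vtx (A : Fin n × Fin n → Bool) (b b' : Bool) (i j : Fin n) :
    (bipGraph A).Adj (vtx b i) (vtx b' j) ↔ b' = !b ∧ A (cell b i j) = true := by
  cases b <;> cases b' <;> simp [bipGraph, vtx, cell]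

theorem sideOf_cons (c : Bool) (i : ℕ) (u : List ℕ) : sideOf c (i :: u) = !sideOf c u :=
  Function.iterate_succ_apply' not u.length c

theorem sideOf_of_adj {N : List ℕ → ℕ} {u v : TreeWord N s} (h : (treeGraph N s).Adj u v) :
    sideOf c v.1 = !sideOf c u.1 := by
  rcases h with ⟨i, hv⟩ | ⟨i, hu⟩
  · rw [hv, sideOf_cons]
  · rw [hu, sideOf_cons, Bool.not_not]

theorem IsPlacement.injective_apply (he : IsPlacement ρ e) (r : R) : Function.Injective (e r) :=
  he.injective.comp sigma_mk_injective

theorem IsPlacement.adj_iff (he : IsPlacement ρ e) (hA : Explores A c e) {r : R}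
    {u v : TreeWord (K r) s} :
    (bipGraph A).Adj (vtx (sideOf c u.1) (e r u)) (vtx (sideOf c v.1) (e r v)) ↔
      (treeGraph (K r) s).Adj u v := by
  have adj_iff_of_inner : ∀ (w : InnerWord (K r) s) (v : TreeWord (K r) s),
      (bipGraph A).Adj (vtx (sideOf c w.1) (e r w.toTreeWord)) (vtx (sideOf c v.1) (e r v)) ↔
        (treeGraph (K r) s).Adj w.toTreeWord v := by
    intro w v
    rw [bipGraph_adj_vtx, hA r w]
    constructor
    · rintro ⟨_, v', hv', h⟩
      rwa [← he.injective_apply r h]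
    · exact fun h => ⟨sideOf_of_adj h, v, h, rfl⟩
  by_cases hu : u.1.length < s
  · exact adj_iff_of_inner ⟨u.1, u.2.1, hu⟩ v
  by_cases hv : v.1.length < s
  · rw [(bipGraph A).adj_comm, (treeGraph (K r) s).adj_comm]
    exact adj_iff_of_inner ⟨v.1, v.2.1, hv⟩ u
  have hlen : u.1.length = v.1.length :=
    (u.2.2.antisymm (not_lt.1 hu)).trans (v.2.2.antisymm (not_lt.1 hv)).symm
  have hside : sideOf c v.1 ≠ !sideOf c u.1 := by
    rw [sideOf, sideOf, hlen]
    exact (Bool.not_ne_self _).symm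
  exact iff_of_false (fun h => hside ((bipGraph_adj_vtx A _ _ _ _).1 h).1)
    fun h => hside (sideOf_of_adj h)

theorem LocalFunction.eval_of_explores (g : LocalFunction s) (he : IsPlacement ρ e)
    (hA : Explores A c e) (x : Fin n ⊕ Fin n → I) (r : R) :
    g.eval (bipGraph A) x (vtx c (ρ r)) =
      g.onTree (K r) fun u => x (vtx (sideOf c u.1) (e r u)) := by
  let φ : treeGraph (K r) s ↪g bipGraph A :=
    { toFun := fun u => vtx (sideOf c u.1) (e r u)
      inj' := fun u v huv => he.injective_apply r (vtx_inj.1 huv).2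
      map_rel_iff' := he.adj_iff hA }
  refine g.eval_eq_of_embedding (hasDepthLE_treeGraph (K r) s) φ (fun u p hp y hy => ?_) x
    (congrArg (vtx c) (he.root r))
  let w : InnerWord (K r) s := ⟨u.1, u.2.1, (length_le_of_treeGraph_walk p).trans_lt hp⟩
  obtain ⟨b, j, rfl⟩ := exists_eq_vtx y
  obtain ⟨rfl, hj⟩ := (bipGraph_adj_vtx A _ _ _ _).1 hy
  obtain ⟨v, hv, rfl⟩ := (hA r w j).1 hj
  exact ⟨v, congrArg (vtx · (e r v)) (sideOf_of_adj hv)⟩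

/-! ### Uniqueness of the explored forest -/

theorem exists_cast_of_strictMono_of_range_eq {α : Type*} [LinearOrder α] {k k' : ℕ}
    {f : Fin k → α} {f' : Fin k' → α} (hf : StrictMono f) (hf' : StrictMono f')
    (h : Set.range f = Set.range f') : ∃ hk : k = k', ∀ i, f i = f' (Fin.cast hk i) := by
  obtain rfl : k = k' := by
    have hcard := congrArg Set.ncard h
    rwa [← Set.image_univ, ← Set.image_univ, Set.ncard_image_of_injective _ hf.injective,
      Set.ncard_image_of_injective _ hf'.injective, Set.ncard_univ, Set.ncard_univ, Nat.card_fin,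
      Nat.card_fin] at hcard
  exact ⟨rfl, fun i => congrFun ((hf.range_inj hf').1 h) i⟩

theorem IsPlacement.range_child (he : IsPlacement ρ e) (hA : Explores A c e) (r : R)
    (w : InnerWord (K r) s) :
    Set.range (fun i => e r (w.child i)) =
      {j | A (cell (sideOf c w.1) (e r w.toTreeWord) j) = true ∧ j ≠ e r w.toTreeWord.parent} := by
  ext j
  constructor
  · rintro ⟨i, rfl⟩
    exact ⟨(hA r w _).2 ⟨_, w.adj_child i, rfl⟩,
      fun h => w.child_ne_parent i (he.injective_apply r h)⟩
  · rintro ⟨hj, hpar⟩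
    obtain ⟨v, hadj, rfl⟩ := (hA r w j).1 hj
    obtain ⟨w', i, ⟨hw, rfl⟩ | ⟨rfl, hw⟩⟩ := treeGraph_adj_iff.1 hadj
    · obtain rfl := InnerWord.toTreeWord_injective hw
      exact ⟨i, rfl⟩
    · exact absurd (by rw [hw]; rfl) hpar

theorem IsPlacement.child_unique (he : IsPlacement ρ e) (hA : Explores A c e)
    (he' : IsPlacement ρ e') (hA' : Explores A c e') {r : R} {w : InnerWord (K r) s}
    {w' : InnerWord (K' r) s} (hw : w.1 = w'.1) (heq : e r w.toTreeWord = e' r w'.toTreeWord)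
    (hpar : e r w.toTreeWord.parent = e' r w'.toTreeWord.parent) :
    ∃ hk : K r w.1 = K' r w'.1, ∀ i, e r (w.child i) = e' r (w'.child (Fin.cast hk i)) :=
  exists_cast_of_strictMono_of_range_eq (he.strictMono_child r w) (he'.strictMono_child r w')
    (by rw [he.range_child hA, he'.range_child hA', hw, heq, hpar])

theorem IsPlacement.unique (he : IsPlacement ρ e) (hA : Explores A c e)
    (he' : IsPlacement ρ e') (hA' : Explores A c e') (r : R) (u : TreeWord (K r) s) :
    ∃ u' : TreeWord (K' r) s, u.1 = u'.1 ∧ e r u = e' r u' ∧ e r u.parent = e' r u'.parent := by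
  obtain ⟨u, hu⟩ := u
  induction u with
  | nil =>
    have hroot : e r (treeRoot (K r) s) = e' r (treeRoot (K' r) s) :=
      (he.root r).trans (he'.root r).symm
    exact ⟨treeRoot (K' r) s, rfl, hroot, hroot⟩
  | cons i u ih =>
    let w : InnerWord (K r) s := ⟨u, hu.1.1, hu.2⟩
    obtain ⟨v, hv, heq, hpar⟩ := ih w.toTreeWord.2
    let w' : InnerWord (K' r) s := ⟨v.1, v.2.1, hv ▸ hu.2⟩
    obtain ⟨hk, hchild⟩ := he.child_unique hA he' hA' (w := w) (w' := w') hv heq hpar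
    exact ⟨w'.child (Fin.cast hk ⟨i, hu.1.2⟩), congrArg (i :: ·) hv, hchild ⟨i, hu.1.2⟩, heq⟩

theorem IsPlacement.mem_treeCylinder (he : IsPlacement ρ e) (hA : Explores A c e)
    (he' : IsPlacement ρ e') (hA' : Explores A c e') (r : R) :
    K' r ∈ treeCylinder (K r) s := by
  intro w
  obtain ⟨u, hu, heq, hpar⟩ := he.unique hA he' hA' r w.toTreeWord
  let w' : InnerWord (K' r) s := ⟨u.1, u.2.1, hu ▸ w.2.2⟩
  obtain ⟨hk, -⟩ := he.child_unique hA he' hA' (w := w) (w' := w') hu heq hpar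
  rw [hk]
  exact congrArg (K' r) hu

end Exploration

/-! ### Counting placements -/

open Nat in
theorem descFactorial_le_card_strictMono_mul {ι α : Type*} [Fintype ι] [Finite α] [LinearOrder α]
    (k : ι → ℕ) :
    (Nat.card α).descFactorial (∑ w, k w) ≤
      Nat.card {f : (Σ w, Fin (k w)) ↪ α // ∀ w, StrictMono fun i => f ⟨w, i⟩} *
        ∏ w, (k w)! := by
  classical
  have := Fintype.ofFinite α
  let sorting (f : (Σ w, Fin (k w)) ↪ α) (w : ι) : Equiv.Perm (Fin (k w)) :=
    Tuple.sort fun i => f ⟨w, i⟩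
  let sorted (f : (Σ w, Fin (k w)) ↪ α) : (Σ w, Fin (k w)) ↪ α :=
    (Equiv.sigmaCongrRight (sorting f)).toEmbedding.trans f
  have strictMono_sorted (f) (w) : StrictMono fun i => sorted f ⟨w, i⟩ :=
    (Tuple.monotone_sort fun i => f ⟨w, i⟩).strictMono_of_injective
      ((sorted f).injective.comp sigma_mk_injective)
  have injective : Function.Injective fun f => ((⟨sorted f, strictMono_sorted f⟩ :
      {f : (Σ w, Fin (k w)) ↪ α // ∀ w, StrictMono fun i => f ⟨w, i⟩}), sorting f) := by
    intro f f' h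
    obtain ⟨hsorted, hsorting⟩ := Prod.mk.inj h
    have hsorted := DFunLike.congr_fun (Subtype.mk.inj hsorted)
    ext x
    obtain ⟨y, rfl⟩ := (Equiv.sigmaCongrRight (sorting f)).surjective x
    refine (hsorted y).trans ?_
    change f' (Equiv.sigmaCongrRight (sorting f') y) = _
    rw [hsorting]
  calc (Nat.card α).descFactorial (∑ w, k w) = Nat.card ((Σ w, Fin (k w)) ↪ α) := by
        simp [Fintype.card_embedding_eq]
    _ ≤ _ := Nat.card_le_card_of_injective _ injective
    _ = _ := by simp [Fintype.card_perm]

section Counting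

variable {R : Type*} {n s : ℕ} {ρ : R → Fin n} {K : R → List ℕ → ℕ}

/-- The vertices of generation less than `s` of a forest. -/
abbrev Inner (K : R → List ℕ → ℕ) (s : ℕ) : Type _ := Σ r, InnerWord (K r) s

/-- The vertices of a forest of truncated trees that are not roots, listed by their parents. -/
abbrev Child (K : R → List ℕ → ℕ) (s : ℕ) : Type _ := Σ w : Inner K s, Fin (K w.1 w.2.1)

noncomputable instance fintype_innerWord (N : List ℕ → ℕ) (s : ℕ) : Fintype (InnerWord N s) :=
  Fintype.ofFinite _

noncomputable instance fintype_treeWord (N : List ℕ → ℕ) (s : ℕ) : Fintype (TreeWord N s) :=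
  Fintype.ofFinite _

/-- The numbering of a forest given by its values at the roots and at the other vertices. -/
def place (ρ : R → Fin n) (f : Child K s → Fin n) : Numbering K s n
  | r, ⟨[], _⟩ => ρ r
  | r, ⟨i :: u, h⟩ => f ⟨⟨r, ⟨u, h.1.1, h.2⟩⟩, ⟨i, h.1.2⟩⟩

theorem place_child (ρ : R → Fin n) (f : Child K s → Fin n) (x : Child K s) :
    place ρ f x.1.1 (x.1.2.child x.2) = f x := rfl

theorem place_injective (ρ : R → Fin n) :
    Function.Injective (place ρ : (Child K s → Fin n) → Numbering K s n) := by
  intro f f' h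
  funext x
  rw [← place_child ρ f, h, place_child]

theorem isPlacement_place (hρ : Function.Injective ρ) {f : Child K s → Fin n}
    (hf : Function.Injective f) (hfρ : ∀ x, f x ∉ Set.range ρ)
    (hmono : ∀ w : Inner K s, StrictMono fun i => f ⟨w, i⟩) : IsPlacement ρ (place ρ f) where
  injective := by
    rintro ⟨r, _ | ⟨i, u⟩, hu⟩ ⟨r', _ | ⟨i', u'⟩, hu'⟩ h
    · obtain rfl := hρ h
      rfl
    · exact absurd ⟨r, h⟩ (hfρ _)
    · exact absurd ⟨r', h.symm⟩ (hfρ _)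
    · exact congrArg (fun x : Child K s =>
        (⟨x.1.1, x.1.2.child x.2⟩ : Σ r, TreeWord (K r) s)) (hf h)
  root := fun _ => rfl
  strictMono_child := fun r w => hmono ⟨r, w⟩

open Nat in
theorem descFactorial_le_card_isPlacement_mul [Fintype R] (hρ : Function.Injective ρ)
    (K : R → List ℕ → ℕ) (s : ℕ) :
    (n - Fintype.card R).descFactorial (Fintype.card (Child K s)) ≤
      Nat.card {e : Numbering K s n // IsPlacement ρ e} * ∏ w : Inner K s, (K w.1 w.2.1)! := by
  have hfree : Nat.card {j // j ∉ Set.range ρ} = n - Fintype.card R := by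
    classical
    rw [Nat.card_eq_fintype_card, Fintype.card_subtype_compl, Fintype.card_fin]
    exact congrArg (n - ·) (Set.card_range_of_injective hρ)
  have hcount := descFactorial_le_card_strictMono_mul (α := {j // j ∉ Set.range ρ})
    fun w : Inner K s => K w.1 w.2.1
  simp only [hfree] at hcount
  rw [Fintype.card_sigma]
  simp only [Fintype.card_fin]
  refine hcount.trans (Nat.mul_le_mul_right _ ?_)
  refine Nat.card_le_card_of_injective (fun f => ⟨place ρ fun x => (f.1 x).1,
    isPlacement_place hρ (Subtype.val_injective.comp f.1.injective) (fun x => (f.1 x).2) f.2⟩) ?_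
  intro f f' h
  have heq := congrFun (place_injective ρ (Subtype.mk.inj h))
  exact Subtype.ext (DFunLike.ext _ _ fun x => Subtype.ext (heq x))

end Counting

/-! ### Probability of an exploration -/

theorem bernoulli_pi_real_forall_eq {ι : Type*} [Fintype ι] (p : I) {F D : Finset ι}
    (hFD : Disjoint F D) :
    (Measure.pi fun _ : ι => bernoulliMeasure true false p).real
      {A | (∀ x ∈ F, A x = true) ∧ ∀ x ∈ D, A x = false} =
        (p : ℝ) ^ F.card * (1 - p) ^ D.card := by
  classical
  have hset : {A : ι → Bool | (∀ x ∈ F, A x = true) ∧ ∀ x ∈ D, A x = false} =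
      Set.pi Set.univ fun x => {b | (x ∈ F → b = true) ∧ (x ∈ D → b = false)} := by
    ext A
    simp [Set.mem_pi, forall_and]
  have hfactor (x : ι) : (bernoulliMeasure true false p).real
      {b | (x ∈ F → b = true) ∧ (x ∈ D → b = false)} =
        (if x ∈ F then (p : ℝ) else 1) * if x ∈ D then (1 - p : ℝ) else 1 := by
    have hx : x ∈ F → x ∉ D := (Finset.disjoint_left.1 hFD ·)
    by_cases hF : x ∈ F <;> by_cases hD : x ∈ D <;> simp_all
  rw [hset, measureReal_def, Measure.pi_pi, ENNReal.toReal_prod]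
  simp only [← measureReal_def, hfactor]
  rw [Finset.prod_mul_distrib, Finset.prod_ite_mem, Finset.prod_ite_mem, Finset.univ_inter,
    Finset.univ_inter, Finset.prod_const, Finset.prod_const]

section Cells

variable {R : Type*} [Fintype R] {n s : ℕ} {ρ : R → Fin n} {K : R → List ℕ → ℕ}

/-- The potential edges of the graph that are used by the placed forest. -/
noncomputable def treeCells (c : Bool) (e : Numbering K s n) : Finset (Fin n × Fin n) :=
  Finset.univ.image fun x : Child K s =>
    cell (sideOf c x.1.2.1) (e _ x.1.2.toTreeWord) (e _ (x.1.2.child x.2))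

/-- The potential edges of the graph at the placed vertices of generation less than `s`. -/
noncomputable def exploredCells (c : Bool) (e : Numbering K s n) : Finset (Fin n × Fin n) :=
  Finset.univ.image fun x : Fin n × Inner K s =>
    cell (sideOf c x.2.2.1) (e _ x.2.2.toTreeWord) x.1

theorem card_treeCells_le (c : Bool) (e : Numbering K s n) :
    (treeCells c e).card ≤ Fintype.card (Child K s) :=
  Finset.card_image_le

theorem card_exploredCells_le (c : Bool) (e : Numbering K s n) :
    (exploredCells c e).card ≤ n * Fintype.card (Inner K s) :=
  Finset.card_image_le.trans_eq (by rw [Finset.card_univ, Fintype.card_prod, Fintype.card_fin])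

theorem IsPlacement.cell_mem_treeCells_iff {e : Numbering K s n} (he : IsPlacement ρ e) (c : Bool)
    (r : R) (w : InnerWord (K r) s) (j : Fin n) :
    cell (sideOf c w.1) (e r w.toTreeWord) j ∈ treeCells c e ↔
      ∃ v, (treeGraph (K r) s).Adj w.toTreeWord v ∧ e r v = j := by
  rw [treeCells, Finset.mem_image]
  constructor
  · rintro ⟨⟨⟨r', w'⟩, i⟩, -, h⟩
    rcases eq_or_eq_swap_of_cell_eq h with ⟨hw, rfl⟩ | ⟨rfl, hw⟩
    · obtain ⟨rfl, hw⟩ := Sigma.mk.inj (he.injective (a₁ := ⟨r', _⟩) (a₂ := ⟨r, _⟩) hw)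
      obtain rfl := InnerWord.toTreeWord_injective (eq_of_heq hw)
      exact ⟨_, w'.adj_child i, rfl⟩
    · obtain ⟨rfl, hw⟩ := Sigma.mk.inj (he.injective (a₁ := ⟨r', _⟩) (a₂ := ⟨r, _⟩) hw)
      have hw : w'.child i = w.toTreeWord := eq_of_heq hw
      exact ⟨w'.toTreeWord, hw ▸ (w'.adj_child i).symm, rfl⟩
  · rintro ⟨v, hadj, rfl⟩
    obtain ⟨w', i, ⟨hw, rfl⟩ | ⟨rfl, hw⟩⟩ := treeGraph_adj_iff.1 hadj
    · obtain rfl := InnerWord.toTreeWord_injective hw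
      exact ⟨⟨⟨r, w⟩, i⟩, Finset.mem_univ _, rfl⟩
    · refine ⟨⟨⟨r, w'⟩, i⟩, Finset.mem_univ _, ?_⟩
      have hside : sideOf c w.1 = !sideOf c w'.1 := sideOf_of_adj hadj.symm
      rw [hside, cell_not, hw]

theorem IsPlacement.explores_of_cells {e : Numbering K s n} (he : IsPlacement ρ e) {c : Bool}
    {A : Fin n × Fin n → Bool} (htrue : ∀ x ∈ treeCells c e, A x = true)
    (hfalse : ∀ x ∈ exploredCells c e \ treeCells c e, A x = false) : Explores A c e := by
  intro r w j
  have hexplored : cell (sideOf c w.1) (e r w.toTreeWord) j ∈ exploredCells c e :=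
    Finset.mem_image.2 ⟨(j, ⟨r, w⟩), Finset.mem_univ _, rfl⟩
  rw [← he.cell_mem_treeCells_iff c r w j]
  refine ⟨fun hA => ?_, htrue _⟩
  by_contra hnot
  exact Bool.false_ne_true ((hfalse _ (Finset.mem_sdiff.2 ⟨hexplored, hnot⟩)).symm.trans hA)

theorem IsPlacement.pow_mul_pow_le_explores {e : Numbering K s n} (he : IsPlacement ρ e) (p : I)
    (c : Bool) :
    (p : ℝ) ^ Fintype.card (Child K s) * (1 - p) ^ (n * Fintype.card (Inner K s)) ≤
      (Measure.pi fun _ : Fin n × Fin n => bernoulliMeasure true false p).real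
        {A | Explores A c e} := by
  have hp : (0 : ℝ) ≤ 1 - p := sub_nonneg.2 p.2.2
  have hdiff : (exploredCells c e \ treeCells c e).card ≤ n * Fintype.card (Inner K s) :=
    (Finset.card_le_card Finset.sdiff_subset).trans (card_exploredCells_le c e)
  calc (p : ℝ) ^ Fintype.card (Child K s) * (1 - p) ^ (n * Fintype.card (Inner K s))
      ≤ (p : ℝ) ^ (treeCells c e).card * (1 - p) ^ (exploredCells c e \ treeCells c e).card :=
        mul_le_mul (pow_le_pow_of_le_one p.2.1 p.2.2 (card_treeCells_le c e))
          (pow_le_pow_of_le_one hp (sub_le_self _ p.2.1) hdiff) (pow_nonneg hp _)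
          (pow_nonneg p.2.1 _)
    _ = _ := (bernoulli_pi_real_forall_eq p Finset.disjoint_sdiff).symm
    _ ≤ _ := measureReal_mono fun A hA => he.explores_of_cells hA.1 hA.2

end Cells

/-! ### Independent coordinates along injective maps -/

section Coordinates

variable {ι : Type*} {X : ι → Type*} [∀ i, MeasurableSpace (X i)] (P : ∀ i, Measure (X i))
  [∀ i, IsProbabilityMeasure (P i)]

theorem infinitePi_real_comp {κ : Type*} [Fintype κ] {e : κ → ι} (he : Function.Injective e)
    {B : Set (∀ k, X (e k))} (hB : MeasurableSet B) :
    (Measure.infinitePi P).real {x | (fun k => x (e k)) ∈ B} =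
      (Measure.pi fun k => P (e k)).real B := by
  rw [← Measure.infinitePi_eq_pi, ← Measure.map_infinitePi_infinitePi_of_inj (P := P) he,
    map_measureReal_apply (by fun_prop) hB]
  rfl

theorem infinitePi_real_forall_comp {R : Type*} [Fintype R] {κ : R → Type*} [∀ r, Fintype (κ r)]
    {e : ∀ r, κ r → ι} (he : Function.Injective fun p : Σ r, κ r => e p.1 p.2)
    {B : ∀ r, Set (∀ k, X (e r k))} (hB : ∀ r, MeasurableSet (B r)) :
    (Measure.infinitePi P).real {x | ∀ r, (fun k => x (e r k)) ∈ B r} =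
      ∏ r, (Measure.pi fun k => P (e r k)).real (B r) := by
  have hcurry := Measure.infinitePi_map_piCurry fun r k => P (e r k)
  rw [← Measure.map_infinitePi_infinitePi_of_inj (P := P) he,
    Measure.map_map (by fun_prop) (by fun_prop)] at hcurry
  calc (Measure.infinitePi P).real {x | ∀ r, (fun k => x (e r k)) ∈ B r}
      = ((Measure.infinitePi P).map (MeasurableEquiv.piCurry (fun r k => X (e r k)) ∘
          fun x p => x (e p.1 p.2))).real (Set.univ.pi B) := by
        rw [map_measureReal_apply (by fun_prop) (.univ_pi hB)]
        congr 1
        ext x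
        simp only [Set.mem_preimage, Set.mem_univ_pi]
        rfl
    _ = ∏ r, (Measure.pi fun k => P (e r k)).real (B r) := by
        rw [hcurry, Measure.infinitePi_eq_pi, measureReal_def, Measure.pi_pi, ENNReal.toReal_prod]
        simp only [Measure.infinitePi_eq_pi, measureReal_def]

end Coordinates

/-! ### Decomposition of the Galton-Watson tree by its shape -/

theorem hasSum_measureReal_iUnion {Ω ι : Type*} [MeasurableSpace Ω] {μ : Measure Ω}
    [IsFiniteMeasure μ] [Countable ι] {f : ι → Set Ω} (hd : Pairwise (Function.onFun Disjoint f))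
    (hf : ∀ i, MeasurableSet (f i)) : HasSum (fun i => μ.real (f i)) (μ.real (⋃ i, f i)) := by
  have hsum : ∑' i, μ (f i) = μ (⋃ i, f i) := (measure_iUnion hd hf).symm
  have hasSum := ENNReal.hasSum_toReal (hsum ▸ measure_ne_top μ _)
  rwa [← ENNReal.tsum_toReal_eq fun _ => measure_ne_top _ _, hsum] at hasSum

section Shape

variable {s : ℕ}

/-- The offspring functions that vanish outside the vertices of generation less than `s`; they
parametrize the plane trees of depth at most `s`. -/
abbrev Shape (s : ℕ) : Type :=
  {K : List ℕ → ℕ // ∀ u, ¬(IsTreeVertex K u ∧ u.length < s) → K u = 0}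

/-- The probability that the Galton-Watson tree agrees with the family tree of `K` up to
generation `s`. -/
noncomputable def shapeProb (d : ℝ≥0) (K : List ℕ → ℕ) (s : ℕ) : ℝ :=
  ∏ w : InnerWord K s, (poissonMeasure d).real {K w.1}

/-- The probability that the local function has the value `a` on the truncated family tree with
uniform labels. -/
noncomputable def LocalFunction.labelProb (g : LocalFunction s) (K : List ℕ → ℕ) (a : Bool) : ℝ :=
  (Measure.pi fun _ : TreeWord K s => (volume : Measure I)).real (g.onTree K ⁻¹' {a})

/-- The event that the Galton-Watson tree agrees with the family tree of `K` up to generation `s`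
and that the local function has the value `a` on it. -/
def LocalFunction.shapeEvent (g : LocalFunction s) (K : List ℕ → ℕ) (a : Bool) :
    Set ((List ℕ → ℕ) × (List ℕ → I)) :=
  treeCylinder K s ×ˢ {x | (fun u : TreeWord K s => x u.1) ∈ g.onTree K ⁻¹' {a}}

/-- The value of a local function at the root of the family tree. -/
def LocalFunction.gwOutput (g : LocalFunction s) (ω : (List ℕ → ℕ) × (List ℕ → I)) : Bool :=
  g.eval (gwTree ω.1) (fun u => ω.2 u.1) (gwRoot ω.1)

instance countable_shape : Countable (Shape s) := by
  have finite_support (K : Shape s) : (Function.support K.1).Finite := by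
    refine (Set.finite_range fun w : InnerWord K.1 s => w.1).subset fun u hu => ?_
    by_contra h
    exact hu (K.2 u fun hu' => h ⟨⟨u, hu'⟩, rfl⟩)
  refine Function.Injective.countable (f := fun K : Shape s =>
    (Finsupp.ofSupportFinite K.1 (finite_support K) : List ℕ →₀ ℕ)) fun K K' h => ?_
  exact Subtype.ext (congrArg (fun f : List ℕ →₀ ℕ => (f : List ℕ → ℕ)) h)

theorem Shape.eq_of_mem_treeCylinder {K K' : Shape s} {N : List ℕ → ℕ}
    (h : N ∈ treeCylinder K.1 s) (h' : N ∈ treeCylinder K'.1 s) : K = K' := by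
  refine Subtype.ext (funext fun u => ?_)
  by_cases hu : u.length < s
  · have hiff := isTreeVertex_iff_of_mem_treeCylinder h hu.le
    have hiff' := isTreeVertex_iff_of_mem_treeCylinder h' hu.le
    by_cases hN : IsTreeVertex N u
    · rw [← h ⟨u, hiff.1 hN, hu⟩, ← h' ⟨u, hiff'.1 hN, hu⟩]
    · rw [K.2 u fun hK => hN (hiff.2 hK.1), K'.2 u fun hK => hN (hiff'.2 hK.1)]
  · rw [K.2 u fun hK => hu hK.2, K'.2 u fun hK => hu hK.2]

theorem exists_shape_mem_treeCylinder (N : List ℕ → ℕ) (s : ℕ) :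
    ∃ K : Shape s, N ∈ treeCylinder K.1 s := by
  classical
  let K : List ℕ → ℕ := fun u => if IsTreeVertex N u ∧ u.length < s then N u else 0
  have isTreeVertex_of_K (u : List ℕ) (hu : IsTreeVertex K u) : IsTreeVertex N u := by
    induction u with
    | nil => trivial
    | cons i u ih =>
      have hle : K u ≤ N u := by
        dsimp only [K]
        split_ifs
        exacts [le_rfl, Nat.zero_le _]
      exact ⟨ih hu.1, hu.2.trans_le hle⟩
  have hN : N ∈ treeCylinder K s := fun w => (if_pos ⟨isTreeVertex_of_K _ w.2.1, w.2.2⟩).symm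
  exact ⟨⟨K, fun u hu => if_neg fun h =>
    hu ⟨(isTreeVertex_iff_of_mem_treeCylinder hN h.2.le).1 h.1, h.2⟩⟩, hN⟩

theorem LocalFunction.gwOutput_preimage_eq_iUnion (g : LocalFunction s) (a : Bool) :
    g.gwOutput ⁻¹' {a} = ⋃ K : Shape s, g.shapeEvent K.1 a := by
  ext ω
  simp only [Set.mem_iUnion, shapeEvent, Set.mem_prod]
  constructor
  · intro h
    obtain ⟨K, hK⟩ := exists_shape_mem_treeCylinder ω.1 s
    exact ⟨K, hK, (g.eval_gwTree hK ω.2).symm.trans h⟩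
  · rintro ⟨K, hK, h⟩
    exact (g.eval_gwTree hK ω.2).trans h

theorem treeCylinder_eq_preimage (K : List ℕ → ℕ) (s : ℕ) :
    treeCylinder K s = {N | (fun w : InnerWord K s => N w.1) ∈ ({fun w => K w.1} : Set _)} := by
  ext N
  exact funext_iff.symm

theorem LocalFunction.measurableSet_shapeEvent (g : LocalFunction s) (K : List ℕ → ℕ) (a : Bool) :
    MeasurableSet (g.shapeEvent K a) := by
  rw [shapeEvent, treeCylinder_eq_preimage]
  have htree : Measurable fun (N : List ℕ → ℕ) (w : InnerWord K s) => N w.1 := by fun_prop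
  have hlabel : Measurable fun (x : List ℕ → I) (u : TreeWord K s) => x u.1 := by fun_prop
  exact (htree (measurableSet_singleton _)).prod
    (hlabel (g.measurable_onTree K (measurableSet_singleton a)))

theorem LocalFunction.measurable_gwOutput (g : LocalFunction s) : Measurable g.gwOutput := by
  refine measurable_to_countable' fun a => ?_
  rw [gwOutput_preimage_eq_iUnion]
  exact MeasurableSet.iUnion fun K => g.measurableSet_shapeEvent K.1 a

instance isProbabilityMeasure_gwMeasure (d : ℝ≥0) : IsProbabilityMeasure (gwMeasure d) := by
  unfold gwMeasure
  infer_instance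

theorem LocalFunction.gwMeasure_real_shapeEvent (g : LocalFunction s) (d : ℝ≥0) (K : List ℕ → ℕ)
    (a : Bool) :
    (gwMeasure d).real (g.shapeEvent K a) = shapeProb d K s * g.labelProb K a := by
  rw [gwMeasure, shapeEvent, measureReal_prod_prod, treeCylinder_eq_preimage,
    infinitePi_real_comp _ Subtype.val_injective (measurableSet_singleton _),
    infinitePi_real_comp _ Subtype.val_injective
      (g.measurable_onTree K (measurableSet_singleton a)),
    measureReal_def, Measure.pi_singleton, ENNReal.toReal_prod]
  rfl

theorem LocalFunction.hasSum_gwOutput (g : LocalFunction s) (d : ℝ≥0) (a : Bool) :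
    HasSum (fun K : Shape s => shapeProb d K.1 s * g.labelProb K.1 a)
      ((gwMeasure d).real (g.gwOutput ⁻¹' {a})) := by
  have hdisjoint : Pairwise (Function.onFun Disjoint fun K : Shape s => g.shapeEvent K.1 a) :=
    fun K K' hne => Set.disjoint_left.2 fun ω h h' =>
      hne (Shape.eq_of_mem_treeCylinder h.1 h'.1)
  simp only [← g.gwMeasure_real_shapeEvent]
  rw [g.gwOutput_preimage_eq_iUnion]
  exact hasSum_measureReal_iUnion hdisjoint fun K => g.measurableSet_shapeEvent K.1 a

theorem gwExpectation_eq_real (d : ℝ≥0) (g : LocalFunction s) :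
    gwExpectation d g = (gwMeasure d).real (g.gwOutput ⁻¹' {true}) := by
  rw [← integral_indicator_one (g.measurable_gwOutput (measurableSet_singleton true)),
    gwExpectation]
  refine integral_congr_ae (.of_forall fun ω => ?_)
  by_cases h : g.gwOutput ω = true
  · exact (if_pos h).trans (Set.indicator_of_mem (s := g.gwOutput ⁻¹' {true}) h 1).symm
  · exact (if_neg h).trans (Set.indicator_of_notMem (s := g.gwOutput ⁻¹' {true}) h 1).symm

end Shape

/-! ### Local convergence of the outputs at finitely many vertices -/

section LocalConvergence

variable {R : Type*} {n s : ℕ} {c : Bool} {ρ : R → Fin n}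

/-- The values of a local function at the vertices number `ρ r` on one side of the random graph. -/
def LocalFunction.graphOutput (g : LocalFunction s) (c : Bool) (ρ : R → Fin n)
    (ω : (Fin n × Fin n → Bool) × (Fin n ⊕ Fin n → I)) (r : R) : Bool :=
  g.eval (bipGraph ω.1) ω.2 (vtx c (ρ r))

instance isProbabilityMeasure_graphLabelMeasure (n : ℕ) (d : ℝ≥0) :
    IsProbabilityMeasure (graphLabelMeasure n d) := by
  unfold graphLabelMeasure
  infer_instance

theorem LocalFunction.measurable_graphOutput (g : LocalFunction s) (c : Bool) (ρ : R → Fin n) :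
    Measurable (g.graphOutput c ρ) := by
  refine measurable_pi_lambda _ fun r => measurable_from_prod_countable_right fun A => ?_
  have hrestrict : Measurable fun (x : Fin n ⊕ Fin n → I)
      (u : nbhd (bipGraph A) s (vtx c (ρ r))) => x u := by fun_prop
  exact (g.measurable_toFun _ _ (hasDepthLE_nbhd (bipGraph A) s (vtx c (ρ r)))).comp hrestrict

/-- The event that the forest of the family trees of `K r` is explored at the places `e`, and that
the labels there give the local function the values `a r`. -/
def LocalFunction.placedEvent (g : LocalFunction s) (c : Bool) (a : R → Bool)
    {K : R → List ℕ → ℕ} (e : Numbering K s n) :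
    Set ((Fin n × Fin n → Bool) × (Fin n ⊕ Fin n → I)) :=
  {A | Explores A c e} ×ˢ
    {x | ∀ r, (fun u : TreeWord (K r) s => x (vtx (sideOf c u.1) (e r u))) ∈
      g.onTree (K r) ⁻¹' {a r}}

theorem LocalFunction.measurableSet_placedEvent [Finite R] (g : LocalFunction s) (c : Bool)
    (a : R → Bool) {K : R → List ℕ → ℕ} (e : Numbering K s n) :
    MeasurableSet (g.placedEvent c a e) := by
  refine (Set.toFinite _).measurableSet.prod ?_
  rw [Set.ofPred_forall]
  refine MeasurableSet.iInter fun r =>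
    MeasurableSet.preimage (g.measurable_onTree (K r) (measurableSet_singleton (a r))) ?_
  fun_prop

theorem LocalFunction.placedEvent_subset (g : LocalFunction s) (a : R → Bool)
    {K : R → List ℕ → ℕ} {e : Numbering K s n} (he : IsPlacement ρ e) :
    g.placedEvent c a e ⊆ g.graphOutput c ρ ⁻¹' {a} := by
  rintro ⟨A, x⟩ ⟨hA, hx⟩
  exact funext fun r => (g.eval_of_explores he hA x r).trans (hx r)

theorem LocalFunction.le_graphLabelMeasure_placedEvent [Fintype R] (d : ℝ≥0) (g : LocalFunction s)
    (c : Bool) (a : R → Bool) {K : R → List ℕ → ℕ} {e : Numbering K s n} (he : IsPlacement ρ e) :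
    (edgeProb n d : ℝ) ^ Fintype.card (Child K s) *
        (1 - edgeProb n d) ^ (n * Fintype.card (Inner K s)) * ∏ r, g.labelProb (K r) (a r) ≤
      (graphLabelMeasure n d).real (g.placedEvent c a e) := by
  have hinj : Function.Injective fun p : Σ r, TreeWord (K r) s =>
      (vtx (sideOf c p.2.1) (e p.1 p.2) : Fin n ⊕ Fin n) :=
    fun p q h => he.injective (vtx_inj.1 h).2
  have hlabel := infinitePi_real_forall_comp (fun _ : Fin n ⊕ Fin n => (volume : Measure I))
    (e := fun r (u : TreeWord (K r) s) => vtx (sideOf c u.1) (e r u)) hinj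
    fun r => g.measurable_onTree (K r) (measurableSet_singleton (a r))
  rw [Measure.infinitePi_eq_pi] at hlabel
  rw [graphLabelMeasure, placedEvent, measureReal_prod_prod, hlabel]
  exact mul_le_mul_of_nonneg_right (he.pow_mul_pow_le_explores _ c)
    (Finset.prod_nonneg fun r _ => measureReal_nonneg)

/-- A plane forest of depth at most `s`, placed in the graph with its roots at `ρ`. -/
abbrev PlacedForest (ρ : R → Fin n) (s : ℕ) : Type _ :=
  Σ K : R → Shape s, {e : Numbering (fun r => (K r).1) s n // IsPlacement ρ e}

theorem PlacedForest.eq_of_explores {t t' : PlacedForest ρ s} {A : Fin n × Fin n → Bool}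
    (hA : Explores A c t.2.1) (hA' : Explores A c t'.2.1) : t = t' := by
  obtain ⟨K, e, he⟩ := t
  obtain ⟨K', e', he'⟩ := t'
  obtain rfl : K = K' := funext fun r =>
    Shape.eq_of_mem_treeCylinder (he.mem_treeCylinder hA he' hA' r) fun _ => rfl
  obtain rfl : e = e' := by
    funext r u
    obtain ⟨u', hu, heq, -⟩ := he.unique hA he' hA' r u
    rw [heq, Subtype.ext hu]
  rfl

theorem LocalFunction.sum_card_isPlacement_mul_le [Fintype R] (d : ℝ≥0) (g : LocalFunction s)
    (c : Bool) (ρ : R → Fin n) (a : R → Bool) (F : Finset (R → Shape s)) :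
    ∑ K ∈ F, (Nat.card {e : Numbering (fun r => (K r).1) s n // IsPlacement ρ e} : ℝ) *
      ((edgeProb n d : ℝ) ^ Fintype.card (Child (fun r => (K r).1) s) *
        (1 - edgeProb n d) ^ (n * Fintype.card (Inner (fun r => (K r).1) s)) *
          ∏ r, g.labelProb (K r).1 (a r)) ≤
      (graphLabelMeasure n d).real (g.graphOutput c ρ ⁻¹' {a}) := by
  classical
  let S : Finset (PlacedForest ρ s) := F.sigma fun K => Finset.univ
  calc _ ≤ ∑ t ∈ S, (graphLabelMeasure n d).real (g.placedEvent c a t.2.1) := by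
        rw [Finset.sum_sigma]
        refine Finset.sum_le_sum fun K _ => ?_
        rw [Nat.card_eq_fintype_card, ← Finset.card_univ, ← nsmul_eq_mul]
        exact Finset.card_nsmul_le_sum _ _ _ fun e _ =>
          g.le_graphLabelMeasure_placedEvent d c a e.2
    _ = (graphLabelMeasure n d).real (⋃ t ∈ S, g.placedEvent c a t.2.1) := by
        refine (measureReal_biUnion_finset ?_ fun t _ => g.measurableSet_placedEvent c a _).symm
        exact fun t _ t' _ hne => Set.disjoint_left.2 fun ω h h' =>
          hne (PlacedForest.eq_of_explores h.1 h'.1)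
    _ ≤ _ := measureReal_mono (Set.iUnion₂_subset fun t _ => g.placedEvent_subset a t.2.2)

theorem tendsto_descFactorial_sub_div_pow (k m : ℕ) :
    Tendsto (fun n : ℕ => ((n - k).descFactorial m : ℝ) / (n : ℝ) ^ m) atTop (𝓝 1) := by
  have hsub : Tendsto (fun n : ℕ => (((n - k : ℕ) : ℝ) / n) ^ m) atTop (𝓝 1) := by
    have hlim := ((tendsto_const_div_atTop_nhds_zero_nat (k : ℝ)).const_sub 1).pow m
    rw [sub_zero, one_pow] at hlim
    refine hlim.congr' ?_
    filter_upwards [eventually_ge_atTop k, eventually_ne_atTop 0] with n hn hn0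
    rw [Nat.cast_sub hn, sub_div, div_self (Nat.cast_ne_zero.2 hn0)]
  have hequiv := ((isEquivalent_descFactorial m).comp_tendsto (tendsto_sub_atTop_nat k)).div
    (Asymptotics.IsEquivalent.refl (u := fun n : ℕ => (n : ℝ) ^ m))
  refine hequiv.symm.tendsto_nhds (hsub.congr fun n => ?_)
  exact div_pow _ _ m

theorem eventually_edgeProb_eq (d : ℝ≥0) :
    ∀ᶠ n : ℕ in atTop, (edgeProb n d : ℝ) = d / n := by
  filter_upwards [(tendsto_const_div_atTop_nhds_zero_nat (d : ℝ)).eventually_le_const one_pos]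
    with n hn
  exact congrArg Subtype.val (Set.projIcc_of_mem _ ⟨by positivity, hn⟩)

open Nat in
theorem prod_shapeProb [Fintype R] (d : ℝ≥0) (K : R → List ℕ → ℕ) (s : ℕ) :
    ∏ r, shapeProb d (K r) s =
      (d : ℝ) ^ Fintype.card (Child K s) * Real.exp (-d) ^ Fintype.card (Inner K s) /
        ∏ w : Inner K s, ((K w.1 w.2.1)! : ℝ) := by
  have hchild : Fintype.card (Child K s) = ∑ w : Inner K s, K w.1 w.2.1 := by
    simp only [Fintype.card_sigma, Fintype.card_fin]
  simp only [shapeProb, poissonMeasure_real_singleton]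
  rw [← Fintype.prod_sigma' (fun (r : R) (u : InnerWord (K r) s) =>
    Real.exp (-d) * (d : ℝ) ^ K r u.1 / ((K r u.1)! : ℝ)), Finset.prod_div_distrib,
    Finset.prod_mul_distrib, Finset.prod_const, Finset.prod_pow_eq_pow_sum, Finset.card_univ,
    mul_comm, hchild]

open Nat in
theorem tendsto_placement_weight [Fintype R] (d : ℝ≥0) (K : R → List ℕ → ℕ) (s : ℕ) :
    Tendsto (fun n : ℕ => ((n - Fintype.card R).descFactorial (Fintype.card (Child K s)) : ℝ) /
        (∏ w : Inner K s, ((K w.1 w.2.1)! : ℝ)) *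
      ((edgeProb n d : ℝ) ^ Fintype.card (Child K s) *
        (1 - edgeProb n d) ^ (n * Fintype.card (Inner K s)))) atTop
      (𝓝 (∏ r, shapeProb d (K r) s)) := by
  have hplaces :=
    tendsto_descFactorial_sub_div_pow (Fintype.card R) (Fintype.card (Child K s))
  have hexp := (Real.tendsto_one_add_div_pow_exp (-(d : ℝ))).pow (Fintype.card (Inner K s))
  rw [prod_shapeProb, ← one_mul ((d : ℝ) ^ _)]
  refine (((hplaces.mul_const ((d : ℝ) ^ Fintype.card (Child K s))).mul hexp).div_const
    (∏ w : Inner K s, ((K w.1 w.2.1)! : ℝ))).congr' ?_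
  filter_upwards [eventually_edgeProb_eq d] with n hn
  rw [hn, ← pow_mul, div_pow, neg_div, ← sub_eq_add_neg]
  ring

open Nat in
theorem LocalFunction.eventually_le_graphOutput [Fintype R] (d : ℝ≥0) (g : LocalFunction s)
    (a : R → Bool) {δ : ℝ} (hδ : 0 < δ) :
    ∀ᶠ n : ℕ in atTop, ∀ (c : Bool) (ρ : R → Fin n), Function.Injective ρ →
      ∏ r, (gwMeasure d).real (g.gwOutput ⁻¹' {a r}) - δ ≤
        (graphLabelMeasure n d).real (g.graphOutput c ρ ⁻¹' {a}) := by
  classical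
  have htree : Tendsto (fun F : Finset (Shape s) =>
      ∏ r, ∑ K ∈ F, shapeProb d K.1 s * g.labelProb K.1 (a r)) atTop
      (𝓝 (∏ r, (gwMeasure d).real (g.gwOutput ⁻¹' {a r}))) :=
    tendsto_finsetProd _ fun r _ => g.hasSum_gwOutput d (a r)
  obtain ⟨F, hF⟩ := (htree.eventually_const_lt (sub_lt_self _ hδ)).exists
  rw [Finset.prod_univ_sum] at hF
  have hgraph := tendsto_finsetSum (Fintype.piFinset fun _ : R => F) fun K _ =>
    (tendsto_placement_weight d (fun r => (K r).1) s).mul_const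
      (∏ r, g.labelProb (K r).1 (a r))
  simp only [Finset.prod_mul_distrib] at hF
  filter_upwards [hgraph.eventually_const_lt hF] with n hn c ρ hρ
  refine hn.le.trans (le_trans (Finset.sum_le_sum fun K _ => ?_)
    (g.sum_card_isPlacement_mul_le d c ρ a (Fintype.piFinset fun _ : R => F)))
  have hfact : (0 : ℝ) < ∏ w : Inner (fun r => (K r).1) s, (((K w.1).1 w.2.1)! : ℝ) :=
    Finset.prod_pos fun w _ => Nat.cast_pos.2 (Nat.factorial_pos _)
  have hlabel : (0 : ℝ) ≤ ∏ r, g.labelProb (K r).1 (a r) :=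
    Finset.prod_nonneg fun r _ => measureReal_nonneg
  have hedge : (0 : ℝ) ≤ edgeProb n d := (edgeProb n d).2.1
  have hnonedge : (0 : ℝ) ≤ 1 - edgeProb n d := sub_nonneg.2 (edgeProb n d).2.2
  rw [mul_assoc]
  refine mul_le_mul_of_nonneg_right ((div_le_iff₀ hfact).2 ?_) (by positivity)
  exact_mod_cast descFactorial_le_card_isPlacement_mul hρ (fun r => (K r).1) s

theorem abs_sub_le_card_mul_of_sum_eq {ι : Type*} [Fintype ι] {p q : ι → ℝ} {δ : ℝ} (hδ : 0 ≤ δ)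
    (hsum : ∑ i, p i = ∑ i, q i) (h : ∀ i, q i - δ ≤ p i) (i : ι) :
    |p i - q i| ≤ Fintype.card ι * δ := by
  have hcard : (1 : ℝ) ≤ Fintype.card ι := Nat.one_le_cast.2 (Fintype.card_pos_iff.2 ⟨i⟩)
  have hexcess : p i - (q i - δ) ≤ ∑ j, (p j - (q j - δ)) :=
    Finset.single_le_sum (f := fun j => p j - (q j - δ)) (fun j _ => sub_nonneg.2 (h j))
      (Finset.mem_univ i)
  simp only [Finset.sum_sub_distrib, hsum, Finset.sum_const, Finset.card_univ,
    nsmul_eq_mul] at hexcess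
  exact abs_le.2 ⟨by nlinarith [h i], by linarith⟩

theorem LocalFunction.eventually_abs_graphOutput_sub_le [Fintype R] (d : ℝ≥0)
    (g : LocalFunction s) {δ : ℝ} (hδ : 0 < δ) :
    ∀ᶠ n : ℕ in atTop, ∀ (c : Bool) (ρ : R → Fin n), Function.Injective ρ → ∀ a : R → Bool,
      |(graphLabelMeasure n d).real (g.graphOutput c ρ ⁻¹' {a}) -
        ∏ r, (gwMeasure d).real (g.gwOutput ⁻¹' {a r})| ≤ δ := by
  classical
  have hcard : (0 : ℝ) < Fintype.card (R → Bool) := Nat.cast_pos.2 Fintype.card_pos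
  filter_upwards [eventually_all.2 fun a : R → Bool =>
    g.eventually_le_graphOutput d a (div_pos hδ hcard)] with n hn c ρ hρ a
  refine (abs_sub_le_card_mul_of_sum_eq (div_pos hδ hcard).le ?_
    (fun a => hn a c ρ hρ) a).trans_eq (mul_div_cancel₀ δ hcard.ne')
  have hgraph : ∑ a, (graphLabelMeasure n d).real (g.graphOutput c ρ ⁻¹' {a}) = 1 := by
    rw [sum_measureReal_preimage_singleton _ fun a _ =>
      g.measurable_graphOutput c ρ (measurableSet_singleton a), Finset.coe_univ,
      Set.preimage_univ, probReal_univ]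
  have htree : ∑ b, (gwMeasure d).real (g.gwOutput ⁻¹' {b}) = 1 := by
    rw [sum_measureReal_preimage_singleton _ fun b _ =>
      g.measurable_gwOutput (measurableSet_singleton b), Finset.coe_univ,
      Set.preimage_univ, probReal_univ]
  have hprod := Finset.prod_univ_sum (fun _ : R => Finset.univ)
    fun _ b => (gwMeasure d).real (g.gwOutput ⁻¹' {b})
  rw [Fintype.piFinset_univ] at hprod
  rw [hgraph, ← hprod, htree, Finset.prod_const_one]

end LocalConvergence

/-! ### Second moment method -/

section SecondMoment

variable {Ω ι : Type*}

theorem indicator_sub_mul_indicator_sub (A B : Set Ω) (m : ℝ) (ω : Ω) :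
    (A.indicator 1 ω - m) * (B.indicator 1 ω - m) =
      (A ∩ B).indicator 1 ω - m * A.indicator 1 ω - m * B.indicator 1 ω + m ^ 2 := by
  rw [Set.inter_indicator_one, Pi.mul_apply]
  ring

theorem sq_ncard_sub_eq_sum [Fintype ι] (E : ι → Set Ω) (m : ℝ) (ω : Ω) :
    (({i | ω ∈ E i}.ncard : ℝ) - Fintype.card ι * m) ^ 2 =
      ∑ i, ∑ j, ((E i).indicator 1 ω - m) * ((E j).indicator 1 ω - m) := by
  classical
  have hncard : ({i | ω ∈ E i}.ncard : ℝ) = ∑ i, (E i).indicator 1 ω := by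
    simp [Set.ncard_eq_toFinset_card', Set.indicator_apply]
  rw [← Finset.sum_mul_sum, ← sq, Finset.sum_sub_distrib, Finset.sum_const, Finset.card_univ,
    nsmul_eq_mul, hncard]

variable [MeasurableSpace Ω] {μ : Measure Ω} [IsProbabilityMeasure μ]

theorem integrable_indicator_sub_mul {A B : Set Ω} (hA : MeasurableSet A) (hB : MeasurableSet B)
    (m : ℝ) : Integrable (fun ω => (A.indicator 1 ω - m) * (B.indicator 1 ω - m)) μ := by
  have hint {C : Set Ω} (hC : MeasurableSet C) : Integrable (C.indicator (1 : Ω → ℝ)) μ :=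
    (integrable_const 1).indicator hC
  simp only [indicator_sub_mul_indicator_sub]
  exact (((hint (hA.inter hB)).sub ((hint hA).const_mul m)).sub
    ((hint hB).const_mul m)).add (integrable_const _)

theorem integral_indicator_sub_mul {A B : Set Ω} (hA : MeasurableSet A) (hB : MeasurableSet B)
    (m : ℝ) : ∫ ω, (A.indicator 1 ω - m) * (B.indicator 1 ω - m) ∂μ =
      μ.real (A ∩ B) - m * μ.real A - m * μ.real B + m ^ 2 := by
  have hint {C : Set Ω} (hC : MeasurableSet C) : Integrable (C.indicator (1 : Ω → ℝ)) μ :=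
    (integrable_const 1).indicator hC
  have hfst : Integrable (fun ω => (A ∩ B).indicator 1 ω - m * A.indicator 1 ω) μ :=
    (hint (hA.inter hB)).sub ((hint hA).const_mul m)
  have hsnd : Integrable
      (fun ω => (A ∩ B).indicator 1 ω - m * A.indicator 1 ω - m * B.indicator 1 ω) μ :=
    hfst.sub ((hint hB).const_mul m)
  simp only [indicator_sub_mul_indicator_sub]
  rw [integral_add hsnd (integrable_const _), integral_sub hfst ((hint hB).const_mul m),
    integral_sub (hint (hA.inter hB)) ((hint hA).const_mul m), integral_const_mul,
    integral_const_mul, integral_indicator_one (hA.inter hB), integral_indicator_one hA,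
    integral_indicator_one hB, integral_const, probReal_univ, one_smul]

variable [Fintype ι] {E : ι → Set Ω} {m δ : ℝ}

theorem integrable_sq_ncard_sub (hE : ∀ i, MeasurableSet (E i)) (m : ℝ) :
    Integrable (fun ω => (({i | ω ∈ E i}.ncard : ℝ) - Fintype.card ι * m) ^ 2) μ := by
  simp only [sq_ncard_sub_eq_sum]
  exact integrable_finsetSum _ fun i _ => integrable_finsetSum _ fun j _ =>
    integrable_indicator_sub_mul (hE i) (hE j) m

theorem integral_sq_ncard_sub_le (hE : ∀ i, MeasurableSet (E i)) (hm : m ∈ Set.Icc (0 : ℝ) 1)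
    (hδ : 0 ≤ δ) (hsingle : ∀ i, m - δ ≤ μ.real (E i))
    (hpair : ∀ i j, i ≠ j → μ.real (E i ∩ E j) ≤ m ^ 2 + δ) :
    ∫ ω, (({i | ω ∈ E i}.ncard : ℝ) - Fintype.card ι * m) ^ 2 ∂μ ≤
      Fintype.card ι + 3 * δ * Fintype.card ι ^ 2 := by
  classical
  have hcovariance (i j : ι) : ∫ ω, ((E i).indicator 1 ω - m) * ((E j).indicator 1 ω - m) ∂μ ≤
      (if i = j then 1 else 0) + 3 * δ := by
    rw [integral_indicator_sub_mul (hE i) (hE j)]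
    split_ifs with hij
    · obtain rfl := hij
      rw [Set.inter_self]
      have hE1 : μ.real (E i) ≤ 1 := measureReal_le_one
      nlinarith [hm.1, hm.2, hsingle i, measureReal_nonneg (μ := μ) (s := E i)]
    · nlinarith [hm.1, hm.2, hsingle i, hsingle j, hpair i j hij]
  have hint (i j : ι) := integrable_indicator_sub_mul (μ := μ) (hE i) (hE j) m
  simp only [sq_ncard_sub_eq_sum]
  rw [integral_finsetSum _ fun i _ => integrable_finsetSum _ fun j _ => hint i j]
  calc ∑ i, ∫ ω, ∑ j, ((E i).indicator 1 ω - m) * ((E j).indicator 1 ω - m) ∂μ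
      = ∑ i, ∑ j, ∫ ω, ((E i).indicator 1 ω - m) * ((E j).indicator 1 ω - m) ∂μ :=
        Finset.sum_congr rfl fun i _ => integral_finsetSum _ fun j _ => hint i j
    _ ≤ ∑ i : ι, ∑ j : ι, ((if i = j then 1 else 0) + 3 * δ) :=
        Finset.sum_le_sum fun i _ => Finset.sum_le_sum fun j _ => hcovariance i j
    _ = Fintype.card ι + 3 * δ * Fintype.card ι ^ 2 := by
        simp only [Finset.sum_add_distrib, Finset.sum_ite_eq, Finset.mem_univ, if_true,
          Finset.sum_const, Finset.card_univ, nsmul_eq_mul]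
        ring

theorem measureReal_le_abs_ncard_sub_mul_sq_le (hE : ∀ i, MeasurableSet (E i))
    (hm : m ∈ Set.Icc (0 : ℝ) 1) (hδ : 0 ≤ δ) (hsingle : ∀ i, m - δ ≤ μ.real (E i))
    (hpair : ∀ i j, i ≠ j → μ.real (E i ∩ E j) ≤ m ^ 2 + δ) {t : ℝ} (ht : 0 ≤ t) :
    μ.real {ω | t ≤ |({i | ω ∈ E i}.ncard : ℝ) - Fintype.card ι * m|} * t ^ 2 ≤
      Fintype.card ι + 3 * δ * Fintype.card ι ^ 2 := by
  have hset : {ω | t ≤ |({i | ω ∈ E i}.ncard : ℝ) - Fintype.card ι * m|} =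
      {ω | t ^ 2 ≤ (({i | ω ∈ E i}.ncard : ℝ) - Fintype.card ι * m) ^ 2} := by
    simp only [sq_le_sq, abs_of_nonneg ht]
  rw [hset, mul_comm]
  exact (mul_meas_ge_le_integral_of_nonneg (.of_forall fun _ => sq_nonneg _)
    (integrable_sq_ncard_sub hE m) _).trans (integral_sq_ncard_sub_le hE hm hδ hsingle hpair)

end SecondMoment

/-! ### Concentration of the outputs on one side of the graph -/

section Concentration

variable {n s : ℕ}

/-- The number of vertices on one side of the random graph at which the local function has the
value `1`. -/
noncomputable def LocalFunction.sideCount (g : LocalFunction s) (c : Bool)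
    (ω : (Fin n × Fin n → Bool) × (Fin n ⊕ Fin n → I)) : ℕ :=
  {i : Fin n | g.eval (bipGraph ω.1) ω.2 (vtx c i) = true}.ncard

theorem gwExpectation_mem_Icc (d : ℝ≥0) (g : LocalFunction s) :
    gwExpectation d g ∈ Set.Icc (0 : ℝ) 1 := by
  rw [gwExpectation_eq_real]
  exact ⟨measureReal_nonneg, measureReal_le_one⟩

theorem LocalFunction.measurableSet_eval_bipGraph (g : LocalFunction s) (c : Bool) (i : Fin n) :
    MeasurableSet {ω : (Fin n × Fin n → Bool) × (Fin n ⊕ Fin n → I) |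
      g.eval (bipGraph ω.1) ω.2 (vtx c i) = true} :=
  (measurable_pi_apply ()).comp (g.measurable_graphOutput c fun _ : Unit => i)
    (measurableSet_singleton true)

theorem LocalFunction.eventually_le_eval (d : ℝ≥0) (g : LocalFunction s) {δ : ℝ} (hδ : 0 < δ) :
    ∀ᶠ n : ℕ in atTop, ∀ (c : Bool) (i : Fin n), gwExpectation d g - δ ≤
      (graphLabelMeasure n d).real {ω | g.eval (bipGraph ω.1) ω.2 (vtx c i) = true} := by
  filter_upwards [g.eventually_le_graphOutput d (fun _ : Unit => true) hδ] with n hn c i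
  have hevent : g.graphOutput c (fun _ : Unit => i) ⁻¹' {fun _ => true} =
      {ω | g.eval (bipGraph ω.1) ω.2 (vtx c i) = true} := by
    ext ω
    exact ⟨fun h => congrFun h (), fun h => funext fun _ => h⟩
  have hbound := hn c (fun _ => i) (Function.injective_of_subsingleton _)
  rwa [hevent, Fintype.prod_unique, ← gwExpectation_eq_real] at hbound

theorem LocalFunction.eventually_eval_inter_le (d : ℝ≥0) (g : LocalFunction s) {δ : ℝ}
    (hδ : 0 < δ) :
    ∀ᶠ n : ℕ in atTop, ∀ (c : Bool) (i j : Fin n), i ≠ j → (graphLabelMeasure n d).real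
      ({ω | g.eval (bipGraph ω.1) ω.2 (vtx c i) = true} ∩
        {ω | g.eval (bipGraph ω.1) ω.2 (vtx c j) = true}) ≤ gwExpectation d g ^ 2 + δ := by
  filter_upwards [g.eventually_abs_graphOutput_sub_le (R := Bool) d hδ] with n hn c i j hij
  let ρ : Bool → Fin n := fun b => cond b i j
  have hρ : Function.Injective ρ := by
    rintro (_ | _) (_ | _) h
    exacts [rfl, absurd h.symm hij, absurd h hij, rfl]
  have hevent : g.graphOutput c ρ ⁻¹' {fun _ => true} =
      {ω | g.eval (bipGraph ω.1) ω.2 (vtx c i) = true} ∩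
        {ω | g.eval (bipGraph ω.1) ω.2 (vtx c j) = true} := by
    ext ω
    simp [graphOutput, funext_iff, ρ, and_comm]
  have hbound := (abs_sub_le_iff.1 (hn c ρ hρ fun _ => true)).1
  rw [hevent, Finset.prod_const, ← gwExpectation_eq_real, Finset.card_univ,
    Fintype.card_bool] at hbound
  linarith

theorem LocalFunction.tendsto_measure_sideCount (d : ℝ≥0) (g : LocalFunction s) (c : Bool) {η : ℝ}
    (hη : 0 < η) :
    Tendsto (fun n : ℕ => (graphLabelMeasure n d)
      {ω | η ≤ |(g.sideCount c ω : ℝ) / n - gwExpectation d g|}) atTop (𝓝 0) := by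
  refine (ENNReal.tendsto_toReal_iff (fun n => measure_ne_top _ _) ENNReal.zero_ne_top).1 ?_
  refine Metric.tendsto_nhds.2 fun ε hε => ?_
  have hδ : 0 < ε * η ^ 2 / 6 := by positivity
  filter_upwards [g.eventually_le_eval d hδ, g.eventually_eval_inter_le d hδ,
    tendsto_natCast_atTop_atTop.eventually_gt_atTop (2 / (ε * η ^ 2))] with n hsingle hpair hn
  have hpos : (0 : ℝ) < n := lt_of_le_of_lt (by positivity) hn
  have hchebyshev := measureReal_le_abs_ncard_sub_mul_sq_le (μ := graphLabelMeasure n d)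
    (fun i => g.measurableSet_eval_bipGraph c i) (gwExpectation_mem_Icc d g) hδ.le (hsingle c)
    (hpair c) (mul_pos hη hpos).le
  have hset : {ω : (Fin n × Fin n → Bool) × (Fin n ⊕ Fin n → I) |
      η ≤ |(g.sideCount c ω : ℝ) / n - gwExpectation d g|} =
      {ω | η * n ≤ |(g.sideCount c ω : ℝ) - n * gwExpectation d g|} := by
    ext ω
    rw [Set.mem_ofPred_eq, Set.mem_ofPred_eq, ← le_div_iff₀ hpos, ← abs_of_pos hpos, ← abs_div,
      abs_of_pos hpos, sub_div, mul_div_cancel_left₀ _ hpos.ne']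
  rw [Fintype.card_fin] at hchebyshev
  rw [ENNReal.toReal_zero, Real.dist_eq, sub_zero, abs_of_nonneg ENNReal.toReal_nonneg, hset]
  have hlarge : 2 < n * (ε * η ^ 2) := (div_lt_iff₀ (by positivity)).1 hn
  have hsmall : (n : ℝ) + 3 * (ε * η ^ 2 / 6) * n ^ 2 < ε * (η * n) ^ 2 := by nlinarith
  exact lt_of_mul_lt_mul_right (hchebyshev.trans_lt hsmall) (sq_nonneg _)

end Concentration

/-! ### Largest balanced subsets of an independent set -/

/-- The real number `min {a / γ, b / (1 - γ)}`, read as `b` for `γ = 0`. Up to a bounded error this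
is the size of a largest `γ`-balanced subset of an independent set with `a` vertices on the left
and `b` vertices on the right. -/
noncomputable def balancedSize (γ a b : ℝ) : ℝ := if γ = 0 then b else min (a / γ) (b / (1 - γ))

theorem balancedValue_eq {s : ℕ} (d : ℝ≥0) (γ : ℝ) (gl gr : LocalFunction s) :
    balancedValue d γ gl gr =
      1 / 2 * balancedSize γ (gwExpectation d gl) (gwExpectation d gr) := by
  simp only [balancedValue, balancedSize, one_div_mul_eq_div, mul_ite]

section BalancedSize

variable {γ a b a' b' c t : ℝ}

theorem balancedSize_div_div (hc : 0 ≤ c) :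
    balancedSize γ (a / c) (b / c) = balancedSize γ a b / c := by
  rw [balancedSize, balancedSize, div_right_comm a, div_right_comm b, min_div_div_right hc]
  split_ifs <;> rfl

theorem mul_balancedSize_le (hγ : 0 ≤ γ) (ha : 0 ≤ a) : γ * balancedSize γ a b ≤ a := by
  rw [balancedSize]
  split_ifs with h
  · rwa [h, zero_mul]
  · rw [← le_div_iff₀' (hγ.lt_of_ne' h)]
    exact min_le_left _ _

theorem one_sub_mul_balancedSize_le (hγ : γ < 1) : (1 - γ) * balancedSize γ a b ≤ b := by
  rw [balancedSize]
  split_ifs with h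
  · rw [h, sub_zero, one_mul]
  · rw [← le_div_iff₀' (sub_pos.2 hγ)]
    exact min_le_right _ _

theorem balancedSize_nonneg (hγ₀ : 0 ≤ γ) (hγ₁ : γ < 1) (ha : 0 ≤ a) (hb : 0 ≤ b) :
    0 ≤ balancedSize γ a b := by
  rw [balancedSize]
  split_ifs
  exacts [hb, le_min (div_nonneg ha hγ₀) (div_nonneg hb (sub_nonneg.2 hγ₁.le))]

-- For `γ = 0` the factor is `0⁻¹ + 1⁻¹ = 1`.
theorem le_balancedSize_add_mul (hγ₀ : 0 ≤ γ) (hγ₁ : γ < 1) (hc : 0 ≤ c) (ha : γ * t ≤ a + c)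
    (hb : (1 - γ) * t ≤ b + c) : t ≤ balancedSize γ a b + (γ⁻¹ + (1 - γ)⁻¹) * c := by
  have hγ : 0 < 1 - γ := sub_pos.2 hγ₁
  rw [balancedSize]
  split_ifs with h
  · subst h
    simpa using hb
  · have hγ_pos : 0 < γ := hγ₀.lt_of_ne' h
    rw [← le_div_iff₀' hγ_pos, add_div] at ha
    rw [← le_div_iff₀' hγ, add_div] at hb
    rw [← min_add_add_right, add_mul, inv_mul_eq_div, inv_mul_eq_div]
    have hleft : 0 ≤ c / γ := by positivity
    have hright : 0 ≤ c / (1 - γ) := by positivity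
    exact le_min (by linarith) (by linarith)

theorem abs_balancedSize_sub_le (hγ₀ : 0 ≤ γ) (hγ₁ : γ < 1) (ha : 0 ≤ a) (ha' : 0 ≤ a')
    (hac : |a - a'| ≤ c) (hbc : |b - b'| ≤ c) :
    |balancedSize γ a b - balancedSize γ a' b'| ≤ (γ⁻¹ + (1 - γ)⁻¹) * c := by
  have hc : 0 ≤ c := (abs_nonneg _).trans hac
  rw [abs_sub_le_iff] at hac hbc ⊢
  constructor <;> rw [sub_le_iff_le_add']
  · exact le_balancedSize_add_mul hγ₀ hγ₁ hc ((mul_balancedSize_le hγ₀ ha).trans (by linarith))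
      ((one_sub_mul_balancedSize_le hγ₁).trans (by linarith))
  · exact le_balancedSize_add_mul hγ₀ hγ₁ hc ((mul_balancedSize_le hγ₀ ha').trans (by linarith))
      ((one_sub_mul_balancedSize_le hγ₁).trans (by linarith))

end BalancedSize

section Balanced

variable {V : Type} [Fintype V] {G : SimpleGraph V} {L X : Set V} {γ : ℝ}

theorem le_maxBalancedCard {J : Finset V} (hJX : (J : Set V) ⊆ X)
    (hJ : IsBalancedIndepSet G L γ (J : Set V)) : J.card ≤ maxBalancedCard G L γ X := by
  classical
  exact Finset.le_sup (f := Finset.card) (Finset.mem_filter.2 ⟨Finset.mem_univ _, hJX, hJ⟩)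

theorem exists_card_eq_maxBalancedCard (G : SimpleGraph V) (L : Set V) (γ : ℝ) (X : Set V) :
    ∃ J : Finset V, (J : Set V) ⊆ X ∧ IsBalancedIndepSet G L γ (J : Set V) ∧
      J.card = maxBalancedCard G L γ X := by
  classical
  have hempty : IsBalancedIndepSet G L γ ((∅ : Finset V) : Set V) := by
    simp [IsBalancedIndepSet, SimpleGraph.IsIndepSet]
  obtain ⟨J, hJ, hcard⟩ := Finset.exists_mem_eq_sup
    {J : Finset V | (J : Set V) ⊆ X ∧ IsBalancedIndepSet G L γ (J : Set V)}
    ⟨∅, Finset.mem_filter.2 ⟨Finset.mem_univ _, by simp, hempty⟩⟩ Finset.card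
  obtain ⟨hJX, hJ⟩ := (Finset.mem_filter.1 hJ).2
  refine ⟨J, hJX, hJ, ?_⟩
  rw [← hcard, maxBalancedCard]

theorem add_le_maxBalancedCard (hX : G.IsIndepSet X) {p q : ℕ} (hp : p ≤ (X ∩ L).ncard)
    (hq : q ≤ (X \ L).ncard) (hpq : |(p : ℝ) - γ * (p + q : ℕ)| < 1) :
    p + q ≤ maxBalancedCard G L γ X := by
  classical
  obtain ⟨P, hP, rfl⟩ := Set.exists_subset_card_eq hp
  obtain ⟨Q, hQ, rfl⟩ := Set.exists_subset_card_eq hq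
  have hdisj : Disjoint P Q := Set.disjoint_left.2 fun v hvP hvQ => (hQ hvQ).2 (hP hvP).2
  have hcard : (P ∪ Q).ncard = P.ncard + Q.ncard := Set.ncard_union_eq hdisj
  have hsub : P ∪ Q ⊆ X := Set.union_subset (fun v hv => (hP hv).1) fun v hv => (hQ hv).1
  have hinter : (P ∪ Q) ∩ L = P := by
    rw [Set.union_inter_distrib_right, Set.inter_eq_left.2 fun v hv => (hP hv).2,
      (Set.disjoint_left.2 fun v hv => (hQ hv).2).inter_eq, Set.union_empty]
  have hbalanced : IsBalancedIndepSet G L γ (P ∪ Q) :=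
    ⟨hX.mono hsub, by rwa [hinter, hcard]⟩
  rw [← hcard, Set.ncard_eq_toFinset_card']
  exact le_maxBalancedCard (by rwa [Set.coe_toFinset]) (by rwa [Set.coe_toFinset])

theorem exists_maxBalancedCard_eq_add (G : SimpleGraph V) (L : Set V) (γ : ℝ) (X : Set V) :
    ∃ p q : ℕ, p ≤ (X ∩ L).ncard ∧ q ≤ (X \ L).ncard ∧ maxBalancedCard G L γ X = p + q ∧
      |(p : ℝ) - γ * (p + q : ℕ)| < 1 := by
  obtain ⟨J, hJX, ⟨-, hJ⟩, hmax⟩ := exists_card_eq_maxBalancedCard G L γ X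
  have hcard : ((J : Set V) ∩ L).ncard + ((J : Set V) \ L).ncard = (J : Set V).ncard :=
    Set.ncard_inter_add_ncard_sdiff_eq_ncard _ _
  refine ⟨((J : Set V) ∩ L).ncard, ((J : Set V) \ L).ncard,
    Set.ncard_le_ncard (Set.inter_subset_inter_left L hJX),
    Set.ncard_le_ncard (Set.sdiff_subset_sdiff_left hJX), ?_, ?_⟩
  · rw [hcard, ← hmax, Set.ncard_coe_finset]
  · rwa [hcard]

-- The `m` vertices are split as `⌊γ m⌋` on the left and `m - ⌊γ m⌋` on the right.
theorem le_maxBalancedCard_of_mul_le (hX : G.IsIndepSet X) (hγ₀ : 0 ≤ γ) (hγ₁ : γ < 1) {m : ℕ}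
    (hleft : γ * m ≤ (X ∩ L).ncard) (hright : (1 - γ) * m ≤ (X \ L).ncard) :
    m ≤ maxBalancedCard G L γ X := by
  have hfloor_le : (⌊γ * m⌋₊ : ℝ) ≤ γ * m := Nat.floor_le (by positivity)
  have hlt_floor : γ * m < ⌊γ * m⌋₊ + 1 := Nat.lt_floor_add_one _
  have hfloor_le_self : ⌊γ * m⌋₊ ≤ m := by
    have : (⌊γ * m⌋₊ : ℝ) ≤ m :=
      hfloor_le.trans (mul_le_of_le_one_left (Nat.cast_nonneg m) hγ₁.le)
    exact_mod_cast this
  have hsub : m - ⌊γ * m⌋₊ ≤ (X \ L).ncard := by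
    have : (m : ℝ) < (X \ L).ncard + 1 + ⌊γ * m⌋₊ := by linarith
    have : m < (X \ L).ncard + 1 + ⌊γ * m⌋₊ := by exact_mod_cast this
    omega
  have hsplit : ⌊γ * m⌋₊ + (m - ⌊γ * m⌋₊) = m := Nat.add_sub_cancel' hfloor_le_self
  have hmax := add_le_maxBalancedCard hX (γ := γ) (by exact_mod_cast hfloor_le.trans hleft) hsub
    (by rw [hsplit, abs_lt]; constructor <;> linarith)
  rwa [hsplit] at hmax

theorem abs_maxBalancedCard_sub_balancedSize_le (hX : G.IsIndepSet X) (hγ₀ : 0 ≤ γ) (hγ₁ : γ < 1) :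
    |(maxBalancedCard G L γ X : ℝ) - balancedSize γ (X ∩ L).ncard (X \ L).ncard| ≤
      γ⁻¹ + (1 - γ)⁻¹ := by
  have hγ : 0 < 1 - γ := sub_pos.2 hγ₁
  rw [abs_sub_le_iff, sub_le_iff_le_add', sub_le_iff_le_add']
  constructor
  · obtain ⟨p, q, hp, hq, hmax, hpq⟩ := exists_maxBalancedCard_eq_add G L γ X
    have hp : (p : ℝ) ≤ (X ∩ L).ncard := by exact_mod_cast hp
    have hq : (q : ℝ) ≤ (X \ L).ncard := by exact_mod_cast hq
    rw [abs_lt] at hpq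
    rw [hmax, ← mul_one (γ⁻¹ + (1 - γ)⁻¹)]
    push_cast at hpq ⊢
    exact le_balancedSize_add_mul hγ₀ hγ₁ zero_le_one (by linarith) (by linarith)
  · set t := balancedSize γ (X ∩ L).ncard (X \ L).ncard
    have hfloor_le : (⌊t⌋₊ : ℝ) ≤ t := Nat.floor_le
      (balancedSize_nonneg hγ₀ hγ₁ (Nat.cast_nonneg _) (Nat.cast_nonneg _))
    have hmax : (⌊t⌋₊ : ℝ) ≤ maxBalancedCard G L γ X := by
      exact_mod_cast le_maxBalancedCard_of_mul_le hX hγ₀ hγ₁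
        ((mul_le_mul_of_nonneg_left hfloor_le hγ₀).trans
          (mul_balancedSize_le hγ₀ (Nat.cast_nonneg _)))
        ((mul_le_mul_of_nonneg_left hfloor_le hγ.le).trans (one_sub_mul_balancedSize_le hγ₁))
    have hone : 1 ≤ γ⁻¹ + (1 - γ)⁻¹ :=
      (one_le_inv_iff₀.2 ⟨hγ, by linarith⟩).trans (le_add_of_nonneg_left (inv_nonneg.2 hγ₀))
    linarith [Nat.lt_floor_add_one t]

end Balanced

/-! ### The output on the random bipartite graph -/

section Output

variable {n s : ℕ} {gl gr : LocalFunction s} {ω : (Fin n × Fin n → Bool) × (Fin n ⊕ Fin n → I)}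
  {d : ℝ≥0} {γ η : ℝ}

theorem isBipartiteWith_bipGraph (A : Fin n × Fin n → Bool) :
    (bipGraph A).IsBipartiteWith (leftSide n) (leftSide n)ᶜ where
  disjoint := disjoint_compl_right
  mem_of_adj := by
    rintro v w (⟨i, j, -, rfl, rfl⟩ | ⟨i, j, -, rfl, rfl⟩) <;> simp [leftSide]

theorem ncard_output_inter_leftSide :
    (output gl gr (bipGraph ω.1) (leftSide n) ω.2 ∩ leftSide n).ncard = gl.sideCount true ω := by
  have himage : output gl gr (bipGraph ω.1) (leftSide n) ω.2 ∩ leftSide n =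
      vtx true '' {i | gl.eval (bipGraph ω.1) ω.2 (vtx true i) = true} := by
    ext (v | v) <;> simp [output, leftSide, vtx]
  rw [himage, Set.ncard_image_of_injective _ fun i j h => (vtx_inj.1 h).2, LocalFunction.sideCount]

theorem ncard_output_sdiff_leftSide :
    (output gl gr (bipGraph ω.1) (leftSide n) ω.2 \ leftSide n).ncard = gr.sideCount false ω := by
  have himage : output gl gr (bipGraph ω.1) (leftSide n) ω.2 \ leftSide n =
      vtx false '' {i | gr.eval (bipGraph ω.1) ω.2 (vtx false i) = true} := by
    ext (v | v) <;> simp [output, leftSide, vtx]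
  rw [himage, Set.ncard_image_of_injective _ fun i j h => (vtx_inj.1 h).2, LocalFunction.sideCount]

theorem abs_maxBalancedCard_output_sub_le (hg : Compatible gl gr) (hγ₀ : 0 ≤ γ) (hγ₁ : γ < 1)
    (hl : |(gl.sideCount true ω : ℝ) / n - gwExpectation d gl| ≤ η)
    (hr : |(gr.sideCount false ω : ℝ) / n - gwExpectation d gr| ≤ η) :
    |(maxBalancedCard (bipGraph ω.1) (leftSide n) γ
        (output gl gr (bipGraph ω.1) (leftSide n) ω.2) : ℝ) / (2 * n) - balancedValue d γ gl gr| ≤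
      1 / 2 * ((γ⁻¹ + (1 - γ)⁻¹) * ((n : ℝ)⁻¹ + η)) := by
  have hcard := abs_maxBalancedCard_sub_balancedSize_le (L := leftSide n)
    (hg _ _ _ (isBipartiteWith_bipGraph ω.1) ω.2) hγ₀ hγ₁
  rw [ncard_output_inter_leftSide, ncard_output_sdiff_leftSide] at hcard
  have hcard_div := div_le_div_of_nonneg_right hcard (Nat.cast_nonneg (α := ℝ) n)
  rw [← Nat.abs_cast (R := ℝ) n, ← abs_div, Nat.abs_cast, sub_div,
    ← balancedSize_div_div (Nat.cast_nonneg n)] at hcard_div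
  have hsize := abs_balancedSize_sub_le hγ₀ hγ₁ (by positivity) (gwExpectation_mem_Icc d gl).1 hl hr
  rw [balancedValue_eq, mul_comm (2 : ℝ), ← div_div, ← one_div_mul_eq_div (2 : ℝ), ← mul_sub,
    abs_mul, abs_of_pos one_half_pos, mul_add, ← div_eq_mul_inv]
  gcongr
  exact (abs_sub_le _ _ _).trans (add_le_add hcard_div hsize)

end Output

end BipLocal

theorem lemma1p4_general (d : ℝ≥0) (γ : ℝ) (hγ₀ : 0 ≤ γ) (hγ₁ : γ < 1) (s : ℕ)
    (gl gr : BipLocal.LocalFunction s) (hg : BipLocal.Compatible gl gr) (ε : ℝ) (hε : 0 < ε) :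
    Tendsto (fun n : ℕ =>
        BipLocal.graphLabelMeasure n d
          {ω | ε < |(BipLocal.maxBalancedCard (BipLocal.bipGraph ω.1) (BipLocal.leftSide n) γ
                (BipLocal.output gl gr (BipLocal.bipGraph ω.1) (BipLocal.leftSide n) ω.2) : ℝ)
              / (2 * (n : ℝ)) - BipLocal.balancedValue d γ gl gr|})
      atTop (𝓝 0) := by
  set C := γ⁻¹ + (1 - γ)⁻¹
  have hC : 0 < C := add_pos_of_nonneg_of_pos (inv_nonneg.2 hγ₀) (inv_pos.2 (sub_pos.2 hγ₁))
  have hη : 0 < ε / C := div_pos hε hC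
  have hlim := (gl.tendsto_measure_sideCount d true hη).add
    (gr.tendsto_measure_sideCount d false hη)
  rw [add_zero] at hlim
  have hinv : ∀ᶠ n : ℕ in atTop, (n : ℝ)⁻¹ < ε / C :=
    tendsto_inv_atTop_nhds_zero_nat.eventually_lt_const hη
  refine tendsto_of_tendsto_of_tendsto_of_le_of_le' tendsto_const_nhds hlim
    (.of_forall fun _ => zero_le) ?_
  filter_upwards [hinv] with n hn
  refine (measure_mono fun ω hω => ?_).trans (measure_union_le _ _)
  by_contra hsides
  simp only [Set.mem_union, Set.mem_ofPred_eq, not_or, not_le] at hsides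
  have hbound := BipLocal.abs_maxBalancedCard_output_sub_le hg hγ₀ hγ₁ hsides.1.le hsides.2.le
  have hsmall : C * ((n : ℝ)⁻¹ + ε / C) ≤ 2 * ε := by
    calc C * ((n : ℝ)⁻¹ + ε / C) ≤ C * (ε / C + ε / C) := by gcongr
      _ = 2 * ε := by field_simp; ring
  exact (hω.trans_le hbound).not_ge (by linarith)

theorem lemma1p4 (d : ℝ≥0) (γ : ℝ) (hγ₀ : 0 ≤ γ) (hγ₁ : γ ≤ 1 / 2) (s : ℕ)
    (gl gr : BipLocal.LocalFunction s) (hg : BipLocal.Compatible gl gr) (ε : ℝ) (hε : 0 < ε) :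
    Tendsto (fun n : ℕ =>
        BipLocal.graphLabelMeasure n d
          {ω | ε < |(BipLocal.maxBalancedCard (BipLocal.bipGraph ω.1) (BipLocal.leftSide n) γ
                (BipLocal.output gl gr (BipLocal.bipGraph ω.1) (BipLocal.leftSide n) ω.2) : ℝ)
              / (2 * (n : ℝ)) - BipLocal.balancedValue d γ gl gr|})
      atTop (𝓝 0) :=
  lemma1p4_general d γ hγ₀ (hγ₁.trans_lt one_half_lt_one) s gl gr hg ε hε
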